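/- **Proposition (Futures Price).** Fix a current time $t_0$, a maturity window $T_{FR}>0$ and a constant $\mu\neq 0$. Let $A(t,x)$, for $t\ge t_0$ and $t\le x\le t+T_{FR}$, be the centred Gaussian field with path weight $e^{S[A]}/Z$, where $$S[A]=-\frac{1}{2T_{FR}}\int_{t_0}^{\infty}dt\int_t^{t+T_{FR}}dx\left\{A^2(t,x)+\frac1{\mu^2}\left(\frac{\partial A(t,x)}{\partial x}\right)^2\right\},$$ that is, the centred Gaussian field (a generalized process in $t$) whose covariance is the inverse of the quadratic form $-2S$. Let the forward rates $f(t,x)$, $t_0\le t\le x\le t_0+T_{FR}$, be a jointly measurable random field satisfying $$\frac{\partial f(t,x)}{\partial t}=\alpha(t,x)+\sigma(t,x)A(t,x),\qquad f(t_0,x)=f_0(x),$$ meaning that for each $(t,x)$, almost surely, $f(t,x)=f_0(x)+\int_{t_0}^t\alpha(s,x)\,ds+\int_{t_0}^t\sigma(s,x)A(s,x)\,ds$. Here the initial curve $f_0$, the drift $\alpha$ and the volatility $\sigma$ are deterministic; $f_0$ is integrable on $[t_0,t_0+T_{FR}]$, $\alpha$ is integrable on $\{t_0\le t\le x\le t_0+T_{FR}\}$,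 and $\sigma$ is measurable and bounded there. Let $P(t,T)=\exp\{-\int_t^T f(t,x)\,dx\}$ be the price at time $t$ of the zero coupon bond maturing at $T$ (so $P(t_0,T)=\exp\{-\int_{t_0}^T f_0(x)\,dx\}$), and suppose that the underlying probability measure is risk neutral: with $r(t)=f(t,t)$, $$P(t_0,T)=E\left[e^{-\int_{t_0}^{t_*}r(t)\,dt}\,P(t_*,T)\right]\qquad\text{for all } t_0\le t_*\le T\le t_0+T_{FR}.$$ Then for all $t_0\le t_*\le T\le t_0+T_{FR}$, almost surely $x\mapsto f(t_*,x)$ is integrable on $[t_*,T]$, the random variable $P(t_*,T)$ is integrable, and the futures price $\mathcal F(t_0,t_*,T)=E[P(t_*,T)]$ satisfies $$\mathcal F(t_0,t_*,T)=\frac{P(t_0,T)}{P(t_0,t_*)}\,\exp\{\Omega_{\mathcal F}(t_0,t_*,T)\},$$ $$\Omega_{\mathcal F}(t_0,t_*,T)=-\int_{t_0}^{t_*}dt\int_t^{t_*}dx\,\sigma(t,x)\int_{t_*}^T dx'\,D(x,x';t,T_{FR})\,\sigma(t,x'),$$ where, with $\tau=x-t$, $\tau'=x'-t$ and $\theta$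 the Heaviside function with $\theta(0)=\tfrac12$, $$\begin{aligned}D(x,x';t,T_{FR})=\frac{\mu T_{FR}}{\sinh(\mu T_{FR})}\Big[&\sinh\mu(T_{FR}-\tau)\sinh(\mu\tau')\,\theta(\tau-\tau')+\sinh\mu(T_{FR}-\tau')\sinh(\mu\tau)\,\theta(\tau'-\tau)\\&+\frac{1}{2\cosh^2(\mu T_{FR}/2)}\Big\{2\cosh\mu\big(\tau-\tfrac{T_{FR}}2\big)\cosh\mu\big(\tau'-\tfrac{T_{FR}}2\big)+\sinh(\mu\tau)\sinh(\mu\tau')\\&\qquad+\sinh\mu(T_{FR}-\tau)\sinh\mu(T_{FR}-\tau')\Big\}\Big].\end{aligned}$$ -/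

import Mathlib

open MeasureTheory ProbabilityTheory

noncomputable section

namespace FieldTheory

/-! Throughout, `TFR` is the length of the maturity window, `μ` the correlation parameter,
`t₀` the current time, and a field or a curve evolution is written `φ t x`, with `t` the calendar
time and `x` the maturity. -/

/-! ### The Lagrangian and the action -/

/-- The space-time domain `t₀ ≤ t`, `t ≤ x ≤ t + TFR` of the field. -/
def fieldDomain (TFR t₀ : ℝ) : Set (ℝ × ℝ) :=
  {p | t₀ ≤ p.1 ∧ p.1 ≤ p.2 ∧ p.2 ≤ p.1 + TFR}

/-- The Lagrangian `-(1 / (2 TFR)) * (φ² + (1 / μ²) * (∂φ/∂x)²)` at the point `(t, x)`. -/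
def lagrangian (μ TFR : ℝ) (φ : ℝ → ℝ → ℝ) (t x : ℝ) : ℝ :=
  -(1 / (2 * TFR)) * ((φ t x) ^ 2 + (1 / μ ^ 2) * (deriv (φ t) x) ^ 2)

/-- The action `S[φ] = ∫_{t₀}^∞ dt ∫_t^{t + TFR} dx (Lagrangian)`. -/
def action (μ TFR t₀ : ℝ) (φ : ℝ → ℝ → ℝ) : ℝ :=
  ∫ t in Set.Ioi t₀, ∫ x in t..(t + TFR), lagrangian μ TFR φ t x

/-- Configurations of finite action: measurable, absolutely continuous in the maturity variable,
and square integrable over the domain together with their maturity derivative. -/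
structure FiniteAction (TFR t₀ : ℝ) (φ : ℝ → ℝ → ℝ) : Prop where
  measurable : Measurable (Function.uncurry φ)
  absolutelyContinuous : ∀ t, t₀ ≤ t → AbsolutelyContinuousOnInterval (φ t) t (t + TFR)
  memLp : MemLp (Function.uncurry φ) 2 (volume.restrict (fieldDomain TFR t₀))
  memLp_deriv : MemLp (fun p : ℝ × ℝ => deriv (φ p.1) p.2) 2
    (volume.restrict (fieldDomain TFR t₀))

/-! ### The Gaussian field of the action -/

/-- The times `t ≥ t₀` at which the maturity `x` lies in the window `[t, t + TFR]`. -/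
def liveTimes (TFR t₀ x : ℝ) : Set ℝ := {t | t₀ ≤ t ∧ t ≤ x ∧ x ≤ t + TFR}

/-- The sources the field is coupled to: a maturity `x` and a square integrable function `h` of
the times at which `x` is live; the coupling is `∫ h(t) A(t, x) dt`. -/
def sources (TFR t₀ : ℝ) : Set (ℝ × (ℝ → ℝ)) :=
  {p | MemLp p.2 2 (volume.restrict (liveTimes TFR t₀ p.1))}

/-- The coupling `∫ h(t) φ(t, x) dt` of the source `(x, h)` to a configuration `φ`. -/
def coupling (TFR t₀ x : ℝ) (h : ℝ → ℝ) (φ : ℝ → ℝ → ℝ) : ℝ :=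
  ∫ t in liveTimes TFR t₀ x, h t * φ t x

/-- `u` is the response of the action to the source `(x, h)`: the configuration of finite action
that maximizes the exponent `∫ h(t) φ(t, x) dt + S[φ]`, i.e. the inverse of the quadratic form
`-2 S` applied to the source. -/
structure IsResponse (μ TFR t₀ x : ℝ) (h : ℝ → ℝ) (u : ℝ → ℝ → ℝ) : Prop where
  finiteAction : FiniteAction TFR t₀ u
  isMax : ∀ φ, FiniteAction TFR t₀ φ →
    coupling TFR t₀ x h φ + action μ TFR t₀ φ ≤ coupling TFR t₀ x h u + action μ TFR t₀ u

variable {Ω : Type*} [MeasurableSpace Ω]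

/-- `A` is, under `Q`, the field with path weight `e^{S[A]} / Z`. The action is a negative
definite quadratic form, so this is the centred Gaussian field whose covariance is the inverse of
the form `-2 S`. The field is a distribution in time: `A x h` is the random variable
`∫ h(t) A(t, x) dt`. -/
structure IsActionField (Q : Measure Ω) (μ TFR t₀ : ℝ) (A : ℝ → (ℝ → ℝ) → Ω → ℝ) : Prop where
  gaussian : IsGaussianProcess (fun p : sources TFR t₀ => A p.1.1 p.1.2) Q
  centred : ∀ p ∈ sources TFR t₀, ∫ ω, A p.1 p.2 ω ∂Q = 0
  covariance : ∀ p ∈ sources TFR t₀, ∀ q ∈ sources TFR t₀, ∀ u : ℝ → ℝ → ℝ,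
    IsResponse μ TFR t₀ p.1 p.2 u →
      cov[A p.1 p.2, A q.1 q.2; Q] = coupling TFR t₀ q.1 q.2 u

/-! ### The propagator -/

/-- The Heaviside function, with the symmetric convention `θ(0) = 1/2`. -/
def heaviside (s : ℝ) : ℝ := if 0 < s then 1 else if s = 0 then 1 / 2 else 0

/-- The propagator `D(x, x'; t, TFR)`. -/
def propagator (μ TFR x x' t : ℝ) : ℝ :=
  let τ := x - t
  let τ' := x' - t
  μ * TFR / Real.sinh (μ * TFR) *
    (Real.sinh (μ * (TFR - τ)) * Real.sinh (μ * τ') * heaviside (τ - τ')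
      + Real.sinh (μ * (TFR - τ')) * Real.sinh (μ * τ) * heaviside (τ' - τ)
      + 1 / (2 * Real.cosh (μ * TFR / 2) ^ 2) *
        (2 * Real.cosh (μ * (τ - TFR / 2)) * Real.cosh (μ * (τ' - TFR / 2))
          + Real.sinh (μ * τ) * Real.sinh (μ * τ')
          + Real.sinh (μ * (TFR - τ)) * Real.sinh (μ * (TFR - τ'))))

/-! ### Forward rates, bonds and futures -/

/-- The pairs of a time and a maturity with `t₀ ≤ t ≤ x ≤ t₀ + TFR`. -/
def rateDomain (TFR t₀ : ℝ) : Set (ℝ × ℝ) :=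
  {p | t₀ ≤ p.1 ∧ p.1 ≤ p.2 ∧ p.2 ≤ t₀ + TFR}

/-- The random field `f t x ω` of forward rates solves `∂f/∂t = α + σ A` with the initial curve
`f₀`, in integrated form: almost surely
`f(t, x) = f₀(x) + ∫_{t₀}^t α(s, x) ds + ∫_{t₀}^t σ(s, x) A(s, x) ds`. -/
structure IsForwardRate (Q : Measure Ω) (TFR t₀ : ℝ) (A : ℝ → (ℝ → ℝ) → Ω → ℝ)
    (α σ : ℝ → ℝ → ℝ) (f₀ : ℝ → ℝ) (f : ℝ → ℝ → Ω → ℝ) : Prop where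
  initial_integrable : IntegrableOn f₀ (Set.Icc t₀ (t₀ + TFR))
  drift_integrable : IntegrableOn (Function.uncurry α) (rateDomain TFR t₀)
  volatility_measurable : Measurable (Function.uncurry σ)
  volatility_bounded : ∃ C : ℝ, ∀ p ∈ rateDomain TFR t₀, |σ p.1 p.2| ≤ C
  measurable : Measurable (fun p : ℝ × ℝ × Ω => f p.1 p.2.1 p.2.2)
  evolution : ∀ t x, (t, x) ∈ rateDomain TFR t₀ → ∀ᵐ ω ∂Q,
    f t x ω = f₀ x + (∫ s in t₀..t, α s x)
      + A x (Set.indicator (Set.Icc t₀ t) (fun s => σ s x)) ω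

/-- The price at time `t` of the zero coupon bond maturing at `T`, when the forward rate curve at
time `t` is `g`. -/
def bondPrice (g : ℝ → ℝ) (t T : ℝ) : ℝ := Real.exp (-∫ x in t..T, g x)

/-- `Q` is a risk neutral measure: with the spot rate `r(t) = f(t, t)`,
`P(t₀, T) = E[exp(-∫_{t₀}^{s} r(t) dt) P(s, T)]` for all `t₀ ≤ s ≤ T ≤ t₀ + TFR`. -/
def IsRiskNeutral (Q : Measure Ω) (TFR t₀ : ℝ) (f₀ : ℝ → ℝ) (f : ℝ → ℝ → Ω → ℝ) : Prop :=
  ∀ s T, t₀ ≤ s → s ≤ T → T ≤ t₀ + TFR →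
    bondPrice f₀ t₀ T =
      ∫ ω, Real.exp (-∫ t in t₀..s, f t t ω) * bondPrice (fun x => f s x ω) s T ∂Q

/-- The futures price `E[P(s, T)]` of the contract expiring at `s` on the bond maturing at `T`. -/
def futuresPrice (Q : Measure Ω) (f : ℝ → ℝ → Ω → ℝ) (s T : ℝ) : ℝ :=
  ∫ ω, bondPrice (fun x => f s x ω) s T ∂Q

/-- The forward price `P(t₀, T) / P(t₀, s)`. -/
def forwardPrice (f₀ : ℝ → ℝ) (t₀ s T : ℝ) : ℝ := bondPrice f₀ t₀ T / bondPrice f₀ t₀ s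

/-- `Ω_F(t₀, s, T) = -∫_{t₀}^{s} dt ∫_t^{s} dx σ(t, x) ∫_{s}^T dx' D(x, x'; t, TFR) σ(t, x')`. -/
def futuresExponent (μ TFR : ℝ) (σ : ℝ → ℝ → ℝ) (t₀ s T : ℝ) : ℝ :=
  -∫ t in t₀..s, ∫ x in t..s, σ t x * ∫ x' in s..T, propagator μ TFR x x' t * σ t x'

end FieldTheory

end

/-! The action contains no derivative in calendar time, so the form `-2 S` splits into independent
forms `(1 / TFR) ∫ (φ² + φ'² / μ²)` on the windows `[t, t + TFR]`. The inverse of each is the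
Neumann Green function of `(1 / TFR) (1 - μ⁻² ∂²)`, and hyperbolic identities show that the
propagator `D` is this function (`propagator_eq_green`). Formally `A(t, x)` and `A(t', x')` have
covariance `δ(t - t') D(x, x'; t)`. Rigorously, completing the square in each window shows that the
response to a source `(x, h)` is `h(t) D(x, y; t)` (`isResponse_response`), whence the noise in two
forward rates has covariance `∫ σ σ D` over their common past
(`IsActionField.covariance_rateSource`).

Write the integrated spot rate as `D1 + G1` and the integrated terminal curve as `D2 + G2`, with
`D1`, `D2` deterministic and `G1`, `G2` centred Gaussian. Risk neutrality for the bonds maturing at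
`T` and at `ts` reads `P(t₀, T) = exp(-D1 - D2 + Var(G1 + G2) / 2)` and `P(t₀, ts) = exp(-D1 +
Var(G1) / 2)`. In the quotient `D1` and `Var(G1)` cancel, leaving `exp(-D2 + Var(G2) / 2) = E[P(ts,
T)]` times `exp(Cov(G1, G2))`. Fubini identifies `-Cov(G1, G2)` with the futures exponent. The drift
is never computed: risk neutrality supplies all that is needed about it.

The delicate point is that `G1` and `G2` are pathwise integrals over maturities, while each rate is
tied to the field only almost surely for fixed maturity. They are placed in the closed `L²` span of
the field by a duality argument (`exists_mem_closedSubmodule_integral`), and every element of that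
span is Gaussian because characteristic functions pass to `L²` limits. -/

noncomputable section

namespace FieldTheory

/-! ### The propagator as a Neumann Green function -/

/-- The Green function of `(1 / TFR) (1 - (1 / μ²) ∂²)` on `[0, TFR]` with Neumann boundary
conditions. -/
def green (μ TFR a b : ℝ) : ℝ :=
  μ * TFR / Real.sinh (μ * TFR) *
    (Real.cosh (μ * (TFR - max a b)) * Real.cosh (μ * min a b))

lemma green_comm (μ TFR a b : ℝ) : green μ TFR a b = green μ TFR b a := by
  rw [green, green, max_comm, min_comm]

/-- With variables centred at the middle of the window, the three terms of the inner bracket combine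
to `2 cosh² p cosh (a + b)`. Adding `cosh (a + b)` turns the Dirichlet product of sinh into the
Neumann product of cosh. -/
lemma cosh_mul_cosh_eq (p a b : ℝ) :
    Real.sinh (p - a) * Real.sinh (p + b) + 1 / (2 * Real.cosh p ^ 2) *
      (2 * Real.cosh a * Real.cosh b + Real.sinh (p + a) * Real.sinh (p + b)
        + Real.sinh (p - a) * Real.sinh (p - b)) = Real.cosh (p - a) * Real.cosh (p + b) := by
  have hc : Real.cosh p ≠ 0 := (Real.cosh_pos p).ne'
  have hs : Real.sinh p ^ 2 = Real.cosh p ^ 2 - 1 := by rw [Real.cosh_sq]; ring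
  have key : 2 * Real.cosh a * Real.cosh b + Real.sinh (p + a) * Real.sinh (p + b)
        + Real.sinh (p - a) * Real.sinh (p - b)
      = 2 * Real.cosh p ^ 2 * (Real.cosh a * Real.cosh b + Real.sinh a * Real.sinh b) := by
    rw [Real.sinh_add, Real.sinh_add, Real.sinh_sub, Real.sinh_sub]
    linear_combination 2 * Real.cosh a * Real.cosh b * hs
  rw [key]
  have e : Real.cosh (p - a) * Real.cosh (p + b) - Real.sinh (p - a) * Real.sinh (p + b)
      = Real.cosh a * Real.cosh b + Real.sinh a * Real.sinh b := by
    rw [← Real.cosh_add, ← Real.cosh_sub, ← Real.cosh_neg (a + b)]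
    ring_nf
  field_simp
  linear_combination -e

lemma propagator_eq_green (μ TFR x x' t : ℝ) :
    propagator μ TFR x x' t = green μ TFR (x - t) (x' - t) := by
  simp only [propagator, green, heaviside]
  congr 1
  generalize x - t = a
  generalize x' - t = b
  have e1 := cosh_mul_cosh_eq (μ * TFR / 2) (μ * a - μ * TFR / 2) (μ * b - μ * TFR / 2)
  have e2 := cosh_mul_cosh_eq (μ * TFR / 2) (μ * b - μ * TFR / 2) (μ * a - μ * TFR / 2)
  have r1 : μ * TFR / 2 - (μ * a - μ * TFR / 2) = μ * (TFR - a) := by ring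
  have r2 : μ * TFR / 2 - (μ * b - μ * TFR / 2) = μ * (TFR - b) := by ring
  have r3 : μ * TFR / 2 + (μ * a - μ * TFR / 2) = μ * a := by ring
  have r4 : μ * TFR / 2 + (μ * b - μ * TFR / 2) = μ * b := by ring
  have r5 : μ * (a - TFR / 2) = μ * a - μ * TFR / 2 := by ring
  have r6 : μ * (b - TFR / 2) = μ * b - μ * TFR / 2 := by ring
  rw [r1, r2, r3, r4] at e1 e2
  rw [r5, r6]
  rcases lt_trichotomy a b with h | h | h
  · rw [max_eq_right h.le, min_eq_left h.le, if_neg (by linarith), if_neg (by linarith),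
      if_pos (by linarith)]
    linear_combination e2
  -- On the diagonal the two Heaviside terms coincide; the convention `θ(0) = 1/2` makes their sum a
  -- single copy.
  · subst h
    simp only [max_self, min_self, sub_self, lt_irrefl, if_true, if_false]
    linear_combination e1
  · rw [max_eq_left h.le, min_eq_right h.le, if_pos (by linarith),
      if_neg (by linarith), if_neg (by linarith)]
    linear_combination e1

lemma mul_div_sinh_pos {μ TFR : ℝ} (hμ : μ ≠ 0) (hT : 0 < TFR) :
    0 < μ * TFR / Real.sinh (μ * TFR) := by
  rcases lt_or_gt_of_ne hμ with h | h
  · have : μ * TFR < 0 := mul_neg_of_neg_of_pos h hT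
    exact div_pos_of_neg_of_neg this (Real.sinh_neg_iff.2 this)
  · have : 0 < μ * TFR := mul_pos h hT
    exact div_pos this (Real.sinh_pos_iff.2 this)

lemma green_pos {μ TFR : ℝ} (hμ : μ ≠ 0) (hT : 0 < TFR) (a b : ℝ) : 0 < green μ TFR a b :=
  mul_pos (mul_div_sinh_pos hμ hT) (mul_pos (Real.cosh_pos _) (Real.cosh_pos _))

lemma cosh_mul_le {μ T a : ℝ} (ha : 0 ≤ a) (haT : a ≤ T) :
    Real.cosh (μ * a) ≤ Real.cosh (μ * T) := by
  rw [Real.cosh_le_cosh, abs_mul, abs_mul, abs_of_nonneg ha, abs_of_nonneg (ha.trans haT)]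
  gcongr

/-- An upper bound for the Green function on `[0, TFR]`. -/
def greenBound (μ TFR : ℝ) : ℝ :=
  μ * TFR / Real.sinh (μ * TFR) * (Real.cosh (μ * TFR) * Real.cosh (μ * TFR))

lemma greenBound_pos {μ TFR : ℝ} (hμ : μ ≠ 0) (hT : 0 < TFR) : 0 < greenBound μ TFR :=
  mul_pos (mul_div_sinh_pos hμ hT) (mul_pos (Real.cosh_pos _) (Real.cosh_pos _))

lemma green_le {μ TFR a b : ℝ} (hμ : μ ≠ 0) (hT : 0 < TFR)
    (ha : a ∈ Set.Icc 0 TFR) (hb : b ∈ Set.Icc 0 TFR) : green μ TFR a b ≤ greenBound μ TFR := by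
  obtain ⟨ha0, haT⟩ := ha
  obtain ⟨hb0, hbT⟩ := hb
  have h1 : Real.cosh (μ * (TFR - max a b)) ≤ Real.cosh (μ * TFR) :=
    cosh_mul_le (by simp [haT, hbT]) (by simp [ha0])
  have h2 : Real.cosh (μ * min a b) ≤ Real.cosh (μ * TFR) :=
    cosh_mul_le (by simp [ha0, hb0]) (by simp [haT])
  have := mul_div_sinh_pos hμ hT
  have := Real.cosh_pos (μ * min a b)
  have := Real.cosh_pos (μ * TFR)
  unfold green greenBound
  gcongr

lemma hasDerivAt_green_left {μ TFR a b : ℝ} (h : a < b) :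
    HasDerivAt (fun a => green μ TFR a b)
      (μ * TFR / Real.sinh (μ * TFR) *
        (Real.cosh (μ * (TFR - b)) * (Real.sinh (μ * a) * μ))) a := by
  have h1 : HasDerivAt (fun a => μ * TFR / Real.sinh (μ * TFR) *
      (Real.cosh (μ * (TFR - b)) * Real.cosh (μ * a)))
      (μ * TFR / Real.sinh (μ * TFR) *
        (Real.cosh (μ * (TFR - b)) * (Real.sinh (μ * a) * μ))) a := by
    have := (((hasDerivAt_id a).const_mul μ).cosh.const_mul
      (Real.cosh (μ * (TFR - b)))).const_mul (μ * TFR / Real.sinh (μ * TFR))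
    simpa using this
  refine h1.congr_of_eventuallyEq ?_
  filter_upwards [gt_mem_nhds h] with c hc
  rw [green, max_eq_right hc.le, min_eq_left hc.le]

lemma hasDerivAt_green_right {μ TFR a b : ℝ} (h : b < a) :
    HasDerivAt (fun a => green μ TFR a b)
      (μ * TFR / Real.sinh (μ * TFR) *
        (-(Real.sinh (μ * (TFR - a)) * μ) * Real.cosh (μ * b))) a := by
  have h1 : HasDerivAt (fun a => μ * TFR / Real.sinh (μ * TFR) *
      (Real.cosh (μ * (TFR - a)) * Real.cosh (μ * b)))
      (μ * TFR / Real.sinh (μ * TFR) *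
        (-(Real.sinh (μ * (TFR - a)) * μ) * Real.cosh (μ * b))) a := by
    have := ((((hasDerivAt_id a).const_sub TFR).const_mul μ).cosh.mul_const
      (Real.cosh (μ * b))).const_mul (μ * TFR / Real.sinh (μ * TFR))
    simpa using this
  refine h1.congr_of_eventuallyEq ?_
  filter_upwards [lt_mem_nhds h] with c hc
  rw [green, max_eq_left hc.le, min_eq_right hc.le]

lemma abs_sinh_le_cosh (x : ℝ) : |Real.sinh x| ≤ Real.cosh x := by
  rw [Real.abs_sinh, ← Real.cosh_abs]
  exact (Real.sinh_lt_cosh _).le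

lemma abs_deriv_green_le {μ TFR a b : ℝ} (hμ : μ ≠ 0) (hT : 0 < TFR)
    (ha : a ∈ Set.Icc 0 TFR) (hb : b ∈ Set.Icc 0 TFR) (hab : a ≠ b) :
    |deriv (fun a => green μ TFR a b) a| ≤ greenBound μ TFR * |μ| := by
  obtain ⟨ha0, haT⟩ := ha
  obtain ⟨hb0, hbT⟩ := hb
  have hK := mul_div_sinh_pos hμ hT
  have hc := Real.cosh_pos (μ * TFR)
  rcases lt_or_gt_of_ne hab with h | h
  · rw [(hasDerivAt_green_left h).deriv, abs_mul, abs_mul, abs_mul, abs_of_pos hK,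
      abs_of_pos (Real.cosh_pos _)]
    have h1 : Real.cosh (μ * (TFR - b)) ≤ Real.cosh (μ * TFR) :=
      cosh_mul_le (by linarith) (by linarith)
    have h2 : |Real.sinh (μ * a)| ≤ Real.cosh (μ * TFR) :=
      (abs_sinh_le_cosh _).trans (cosh_mul_le ha0 haT)
    unfold greenBound
    rw [mul_assoc (μ * TFR / Real.sinh (μ * TFR)), mul_assoc (Real.cosh (μ * TFR))]
    gcongr
  · rw [(hasDerivAt_green_right h).deriv, abs_mul, abs_mul, abs_neg, abs_mul, abs_of_pos hK,
      abs_of_pos (Real.cosh_pos _)]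
    have h1 : |Real.sinh (μ * (TFR - a))| ≤ Real.cosh (μ * TFR) :=
      (abs_sinh_le_cosh _).trans (cosh_mul_le (by linarith) (by linarith))
    have h2 : Real.cosh (μ * b) ≤ Real.cosh (μ * TFR) := cosh_mul_le hb0 hbT
    unfold greenBound
    rw [mul_assoc (μ * TFR / Real.sinh (μ * TFR)), mul_right_comm (Real.cosh (μ * TFR))]
    have := Real.cosh_pos (μ * b)
    gcongr

/-- The kink on the diagonal is harmless: both factors are smooth functions of a 1-Lipschitz
truncation (`max` or `min` with `b`), hence Lipschitz on the window. -/
lemma absolutelyContinuousOnInterval_green (μ TFR b t : ℝ) (hT : 0 < TFR)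
    (hb : b ∈ Set.Icc 0 TFR) :
    AbsolutelyContinuousOnInterval (fun y => green μ TFR (y - t) b) t (t + TFR) := by
  obtain ⟨hb0, hbT⟩ := hb
  have aux : ∀ (ψ : ℝ → ℝ) (m : ℝ → ℝ), ContDiff ℝ 1 ψ → LipschitzWith 1 m →
      Set.MapsTo m (Set.uIcc t (t + TFR)) (Set.Icc 0 TFR) →
      AbsolutelyContinuousOnInterval (fun y => ψ (m y)) t (t + TFR) := by
    intro ψ m hψ hm hmaps
    obtain ⟨K, hK⟩ := hψ.contDiffOn.exists_lipschitzOnWith (by decide) (convex_Icc 0 TFR)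
      isCompact_Icc
    exact (hK.comp (hm.lipschitzOnWith) hmaps).absolutelyContinuousOnInterval
  have hs : LipschitzWith 1 fun y : ℝ => y - t :=
    LipschitzWith.of_dist_le_mul (by simp)
  have hu : ∀ y ∈ Set.uIcc t (t + TFR), 0 ≤ y - t ∧ y - t ≤ TFR := by
    intro y hy
    rw [Set.uIcc_of_le (by linarith)] at hy
    exact ⟨by linarith [hy.1], by linarith [hy.2]⟩
  have h1 := aux (fun z => Real.cosh (μ * (TFR - z))) (fun y => max (y - t) b)
    (by fun_prop) (hs.max_const b) (fun y hy => by
      obtain ⟨p, q⟩ := hu y hy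
      exact ⟨le_max_of_le_right hb0, max_le q hbT⟩)
  have h2 := aux (fun z => Real.cosh (μ * z)) (fun y => min (y - t) b)
    (by fun_prop) (hs.min_const b) (fun y hy => by
      obtain ⟨p, q⟩ := hu y hy
      exact ⟨le_min p hb0, min_le_of_left_le q⟩)
  exact (h1.fun_mul h2).const_mul _

/-! ### The quadratic form of the action on a single window -/

/-- Integration by parts against a solution of `p'' = μ² p`. -/
lemma integral_mul_add_deriv_mul_deriv {μ a b : ℝ} (hμ : μ ≠ 0) {p p' φ : ℝ → ℝ}
    (hp : ∀ y, HasDerivAt p (p' y) y) (hp' : ∀ y, HasDerivAt p' (μ ^ 2 * p y) y)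
    (hφ : AbsolutelyContinuousOnInterval φ a b) :
    ∫ y in a..b, (p y * φ y + 1 / μ ^ 2 * (p' y * deriv φ y))
      = 1 / μ ^ 2 * (p' b * φ b - p' a * φ a) := by
  have hpc : Continuous p := continuous_iff_continuousAt.2 fun y => (hp y).continuousAt
  have hpc' : Continuous p' := continuous_iff_continuousAt.2 fun y => (hp' y).continuousAt
  have hd : deriv p' = fun y => μ ^ 2 * p y := funext fun y => (hp' y).deriv
  have hac : AbsolutelyContinuousOnInterval p' a b := by
    refine ContDiffOn.absolutelyContinuousOnInterval (ContDiff.contDiffOn ?_)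
    rw [contDiff_one_iff_deriv]
    exact ⟨fun y => (hp' y).differentiableAt, by rw [hd]; fun_prop⟩
  have hparts := hac.integral_mul_deriv_eq_deriv_mul hφ
  rw [hd] at hparts
  have hi1 : IntervalIntegrable (fun y => p y * φ y) volume a b :=
    (hpc.continuousOn.mul hφ.continuousOn).intervalIntegrable
  have hi2 : IntervalIntegrable (fun y => p' y * deriv φ y) volume a b :=
    hφ.intervalIntegrable_deriv.continuousOn_mul hpc'.continuousOn
  rw [intervalIntegral.integral_add hi1 (hi2.const_mul _), intervalIntegral.integral_const_mul,
    hparts]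
  simp_rw [mul_assoc, intervalIntegral.integral_const_mul]
  field_simp
  ring

/-- The reproducing property of the Green function for the window's quadratic form. Integrating by
parts on each side of `x`, where `G'' = μ² G`, the outer boundary terms vanish by the Neumann
conditions, and the drop `μ² TFR` of `G'` across `x` produces `TFR * φ x`. -/
lemma green_weak {μ TFR t x : ℝ} (hμ : μ ≠ 0) (hT : 0 < TFR) (htx : t ≤ x) (hxt : x ≤ t + TFR)
    {φ : ℝ → ℝ} (hφ : AbsolutelyContinuousOnInterval φ t (t + TFR)) :
    IntervalIntegrable (fun y => green μ TFR (y - t) (x - t) * φ y + 1 / μ ^ 2 *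
      (deriv (fun z => green μ TFR (z - t) (x - t)) y * deriv φ y)) volume t (t + TFR) ∧
    ∫ y in t..(t + TFR), (green μ TFR (y - t) (x - t) * φ y + 1 / μ ^ 2 *
      (deriv (fun z => green μ TFR (z - t) (x - t)) y * deriv φ y)) = TFR * φ x := by
  have hsT : Real.sinh (μ * TFR) ≠ 0 := by
    rw [Ne, Real.sinh_eq_zero]
    exact mul_ne_zero hμ hT.ne'
  set K := μ * TFR / Real.sinh (μ * TFR) with hK
  have hderiv : ∀ y, deriv (fun z => green μ TFR (z - t) (x - t)) y
      = deriv (fun a => green μ TFR a (x - t)) (y - t) := fun y =>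
    deriv_comp_sub_const (f := fun a => green μ TFR a (x - t)) t y
  have hφ1 : AbsolutelyContinuousOnInterval φ t x := hφ.mono (by
    rw [Set.uIcc_of_le htx, Set.uIcc_of_le (by linarith)]; exact Set.Icc_subset_Icc_right hxt)
  have hφ2 : AbsolutelyContinuousOnInterval φ x (t + TFR) := hφ.mono (by
    rw [Set.uIcc_of_le hxt, Set.uIcc_of_le (by linarith)]; exact Set.Icc_subset_Icc_left htx)
  let p1 : ℝ → ℝ := fun y => K * (Real.cosh (μ * (TFR - (x - t))) * Real.cosh (μ * (y - t)))
  let q1 : ℝ → ℝ := fun y =>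
    K * (Real.cosh (μ * (TFR - (x - t))) * (Real.sinh (μ * (y - t)) * μ))
  let p2 : ℝ → ℝ := fun y => K * (Real.cosh (μ * (TFR - (y - t))) * Real.cosh (μ * (x - t)))
  let q2 : ℝ → ℝ := fun y =>
    K * (-(Real.sinh (μ * (TFR - (y - t))) * μ) * Real.cosh (μ * (x - t)))
  have hp1 : ∀ y, HasDerivAt p1 (q1 y) y := fun y => by
    have := ((((hasDerivAt_id y).sub_const t).const_mul μ).cosh.const_mul
      (Real.cosh (μ * (TFR - (x - t))))).const_mul K
    simpa [p1, q1] using this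
  have hq1 : ∀ y, HasDerivAt q1 (μ ^ 2 * p1 y) y := fun y => by
    have := (((((hasDerivAt_id y).sub_const t).const_mul μ).sinh.mul_const μ).const_mul
      (Real.cosh (μ * (TFR - (x - t))))).const_mul K
    refine this.congr_deriv ?_
    simp only [p1, id]; ring
  have hp2 : ∀ y, HasDerivAt p2 (q2 y) y := fun y => by
    have := (((((hasDerivAt_id y).sub_const t).const_sub TFR).const_mul μ).cosh.mul_const
      (Real.cosh (μ * (x - t)))).const_mul K
    simpa [p2, q2] using this
  have hq2 : ∀ y, HasDerivAt q2 (μ ^ 2 * p2 y) y := fun y => by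
    have := (((((((hasDerivAt_id y).sub_const t).const_sub TFR).const_mul μ).sinh.mul_const
      μ).neg).mul_const (Real.cosh (μ * (x - t)))).const_mul K
    refine this.congr_deriv ?_
    simp only [p2, id]; ring
  have key : ∀ {a b : ℝ} {p q : ℝ → ℝ}, (∀ y, HasDerivAt p (q y) y) →
      (∀ y, HasDerivAt q (μ ^ 2 * p y) y) → AbsolutelyContinuousOnInterval φ a b →
      IntervalIntegrable (fun y => p y * φ y + 1 / μ ^ 2 * (q y * deriv φ y)) volume a b := by
    intro a b p q hp hq hac
    have hpc : Continuous p := continuous_iff_continuousAt.2 fun y => (hp y).continuousAt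
    have hqc : Continuous q := continuous_iff_continuousAt.2 fun y => (hq y).continuousAt
    exact (hpc.continuousOn.mul hac.continuousOn).intervalIntegrable.add
      ((hac.intervalIntegrable_deriv.continuousOn_mul hqc.continuousOn).const_mul _)
  -- The half-open interval `(t, x]` contains the kink `x`, where the left branch's derivative is
  -- not that of `G`; the interval to the right of `x` omits it.
  have hae : ∀ᵐ y : ℝ, y ≠ x := by simp [ae_iff]
  have e1 : ∀ᵐ y, y ∈ Set.uIoc t x → p1 y * φ y + 1 / μ ^ 2 * (q1 y * deriv φ y)
      = green μ TFR (y - t) (x - t) * φ y + 1 / μ ^ 2 *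
        (deriv (fun z => green μ TFR (z - t) (x - t)) y * deriv φ y) := by
    filter_upwards [hae] with y hy hm
    rw [Set.uIoc_of_le htx] at hm
    have hlt : y - t < x - t := by linarith [lt_of_le_of_ne hm.2 hy]
    rw [hderiv, (hasDerivAt_green_left hlt).deriv, green, max_eq_right hlt.le, min_eq_left hlt.le]
  have e2 : ∀ᵐ y, y ∈ Set.uIoc x (t + TFR) → p2 y * φ y + 1 / μ ^ 2 * (q2 y * deriv φ y)
      = green μ TFR (y - t) (x - t) * φ y + 1 / μ ^ 2 *
        (deriv (fun z => green μ TFR (z - t) (x - t)) y * deriv φ y) := by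
    filter_upwards with y hm
    rw [Set.uIoc_of_le hxt] at hm
    have hlt : x - t < y - t := by linarith [hm.1]
    rw [hderiv, (hasDerivAt_green_right hlt).deriv, green, max_eq_left hlt.le, min_eq_right hlt.le]
  have i1 := (key hp1 hq1 hφ1).congr_ae ((ae_restrict_iff' measurableSet_uIoc).2 e1)
  have i2 := (key hp2 hq2 hφ2).congr_ae ((ae_restrict_iff' measurableSet_uIoc).2 e2)
  refine ⟨i1.trans i2, ?_⟩
  rw [← intervalIntegral.integral_add_adjacent_intervals i1 i2,
    ← intervalIntegral.integral_congr_ae e1, ← intervalIntegral.integral_congr_ae e2,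
    integral_mul_add_deriv_mul_deriv hμ hp1 hq1 hφ1,
    integral_mul_add_deriv_mul_deriv hμ hp2 hq2 hφ2]
  -- The addition formula evaluates the drop of the derivative at `x`, which the prefactor `K`
  -- normalizes to `μ² TFR`.
  have hadd : Real.sinh (μ * TFR) = Real.sinh (μ * (x - t)) * Real.cosh (μ * (TFR - (x - t)))
      + Real.cosh (μ * (x - t)) * Real.sinh (μ * (TFR - (x - t))) := by
    rw [← Real.sinh_add]; ring_nf
  have hK' : K * Real.sinh (μ * TFR) = μ * TFR := by rw [hK]; field_simp
  simp only [q1, q2, sub_self, mul_zero, Real.sinh_zero, zero_mul, add_sub_cancel_left, neg_zero]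
  clear_value K
  field_simp
  linear_combination μ * φ x * hK' - μ * K * φ x * hadd

/-- The exponent on a single window is maximized by the Green function. -/
lemma slice_le {μ TFR t x : ℝ} (hμ : μ ≠ 0) (hT : 0 < TFR) (htx : t ≤ x) (hxt : x ≤ t + TFR)
    {φ : ℝ → ℝ} (hφ : AbsolutelyContinuousOnInterval φ t (t + TFR))
    (hφ2 : IntervalIntegrable (fun y => φ y ^ 2 + 1 / μ ^ 2 * deriv φ y ^ 2) volume t (t + TFR))
    (c : ℝ) :
    2 * c * φ x * TFR - ∫ y in t..(t + TFR), (φ y ^ 2 + 1 / μ ^ 2 * deriv φ y ^ 2)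
      ≤ c ^ 2 * TFR * green μ TFR (x - t) (x - t) := by
  have hb : x - t ∈ Set.Icc 0 TFR := ⟨by linarith, by linarith⟩
  have hG := absolutelyContinuousOnInterval_green μ TFR (x - t) t hT hb
  obtain ⟨i1, w1⟩ := green_weak hμ hT htx hxt hφ
  obtain ⟨i2, w2⟩ := green_weak hμ hT htx hxt hG
  -- Completing the square: the form is nonnegative at `φ - c G`, and the reproducing property
  -- evaluates both the cross term and the term in `c²`.
  have hnn : 0 ≤ ∫ y in t..(t + TFR), ((φ y - c * green μ TFR (y - t) (x - t)) ^ 2 + 1 / μ ^ 2 *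
      (deriv φ y - c * deriv (fun z => green μ TFR (z - t) (x - t)) y) ^ 2) :=
    intervalIntegral.integral_nonneg (by linarith) fun y _ => by positivity
  have hexp : ∀ y, (φ y - c * green μ TFR (y - t) (x - t)) ^ 2 + 1 / μ ^ 2 *
      (deriv φ y - c * deriv (fun z => green μ TFR (z - t) (x - t)) y) ^ 2
      = (φ y ^ 2 + 1 / μ ^ 2 * deriv φ y ^ 2)
        - 2 * c * (green μ TFR (y - t) (x - t) * φ y + 1 / μ ^ 2 *
          (deriv (fun z => green μ TFR (z - t) (x - t)) y * deriv φ y))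
        + c ^ 2 * (green μ TFR (y - t) (x - t) * green μ TFR (y - t) (x - t) + 1 / μ ^ 2 *
          (deriv (fun z => green μ TFR (z - t) (x - t)) y *
            deriv (fun z => green μ TFR (z - t) (x - t)) y)) := fun y => by ring
  simp_rw [hexp] at hnn
  rw [intervalIntegral.integral_add (hφ2.sub (i1.const_mul _)) (i2.const_mul _),
    intervalIntegral.integral_sub hφ2 (i1.const_mul _), intervalIntegral.integral_const_mul,
    intervalIntegral.integral_const_mul, w1, w2] at hnn
  linarith

lemma slice_green {μ TFR t x : ℝ} (hμ : μ ≠ 0) (hT : 0 < TFR) (htx : t ≤ x)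
    (hxt : x ≤ t + TFR) :
    ∫ y in t..(t + TFR), (green μ TFR (y - t) (x - t) ^ 2 + 1 / μ ^ 2 *
      deriv (fun z => green μ TFR (z - t) (x - t)) y ^ 2) = TFR * green μ TFR (x - t) (x - t) := by
  have hb : x - t ∈ Set.Icc 0 TFR := ⟨by linarith, by linarith⟩
  simp_rw [pow_two (green _ _ _ _), pow_two (deriv _ _)]
  exact (green_weak hμ hT htx hxt (absolutelyContinuousOnInterval_green μ TFR (x - t) t hT hb)).2

/-- The value of a configuration at a maturity is controlled by its quadratic form. -/
lemma sq_le_slice {μ TFR t x : ℝ} (hμ : μ ≠ 0) (hT : 0 < TFR) (htx : t ≤ x) (hxt : x ≤ t + TFR)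
    {φ : ℝ → ℝ} (hφ : AbsolutelyContinuousOnInterval φ t (t + TFR))
    (hφ2 : IntervalIntegrable (fun y => φ y ^ 2 + 1 / μ ^ 2 * deriv φ y ^ 2) volume t (t + TFR)) :
    φ x ^ 2 ≤ greenBound μ TFR / TFR *
      ∫ y in t..(t + TFR), (φ y ^ 2 + 1 / μ ^ 2 * deriv φ y ^ 2) := by
  have hb : x - t ∈ Set.Icc 0 TFR := ⟨by linarith, by linarith⟩
  have hB := greenBound_pos hμ hT
  -- This `c` maximizes `2 c φ(x) - c² B`, with `B = greenBound μ TFR` bounding the diagonal of the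
  -- Green function.
  have h := slice_le hμ hT htx hxt hφ hφ2 (φ x / greenBound μ TFR)
  have hle := green_le hμ hT hb hb
  set E := ∫ y in t..(t + TFR), (φ y ^ 2 + 1 / μ ^ 2 * deriv φ y ^ 2)
  set B := greenBound μ TFR
  have h3 : (φ x / B) ^ 2 * TFR * green μ TFR (x - t) (x - t) ≤ (φ x / B) ^ 2 * TFR * B := by
    gcongr
  have h4 : 2 * (φ x / B) * φ x * TFR - E ≤ (φ x / B) ^ 2 * TFR * B := h.trans h3
  have h5 : (φ x / B) ^ 2 * TFR * B = φ x ^ 2 * TFR / B := by field_simp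
  have h6 : 2 * (φ x / B) * φ x * TFR = 2 * (φ x ^ 2 * TFR / B) := by field_simp
  have h7 : φ x ^ 2 * TFR / B ≤ E := by linarith
  calc φ x ^ 2 = B / TFR * (φ x ^ 2 * TFR / B) := by field_simp
    _ ≤ B / TFR * E := by gcongr

/-! ### The response of the action to a source -/

lemma measurableSet_fieldDomain (TFR t₀ : ℝ) : MeasurableSet (fieldDomain TFR t₀) := by
  apply IsClosed.measurableSet
  simp only [fieldDomain, Set.ofPred_and]
  exact (isClosed_le continuous_const continuous_fst).inter
    ((isClosed_le continuous_fst continuous_snd).inter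
      (isClosed_le continuous_snd (continuous_fst.add continuous_const)))

lemma liveTimes_eq_Icc (TFR t₀ x : ℝ) : liveTimes TFR t₀ x = Set.Icc (max t₀ (x - TFR)) x := by
  ext t
  simp only [liveTimes, Set.mem_ofPred_eq, Set.mem_Icc, max_le_iff, sub_le_iff_le_add]
  tauto

lemma measurableSet_liveTimes (TFR t₀ x : ℝ) : MeasurableSet (liveTimes TFR t₀ x) := by
  rw [liveTimes_eq_Icc]; exact measurableSet_Icc

/-- The quadratic form of the action on the window at time `t`. -/
def energy (μ TFR : ℝ) (φ : ℝ → ℝ → ℝ) (t : ℝ) : ℝ :=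
  ∫ y in t..(t + TFR), (φ t y ^ 2 + 1 / μ ^ 2 * deriv (φ t) y ^ 2)

lemma action_eq (μ TFR t₀ : ℝ) (φ : ℝ → ℝ → ℝ) :
    action μ TFR t₀ φ = ∫ t in Set.Ioi t₀, -(1 / (2 * TFR)) * energy μ TFR φ t := by
  simp only [action, lagrangian, energy, intervalIntegral.integral_const_mul]

/-- Puts the coupling over the same time axis as the action, so that the exponent becomes one
integral over `t` and can be maximized pointwise. -/
lemma coupling_eq (TFR t₀ x : ℝ) (h : ℝ → ℝ) (φ : ℝ → ℝ → ℝ) :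
    coupling TFR t₀ x h φ
      = ∫ t in Set.Ioi t₀, (liveTimes TFR t₀ x).indicator h t * φ t x := by
  rw [coupling, ← integral_Ici_eq_integral_Ioi]
  have : ∀ t, (liveTimes TFR t₀ x).indicator h t * φ t x
      = (liveTimes TFR t₀ x).indicator (fun t => h t * φ t x) t := fun t => by
    by_cases ht : t ∈ liveTimes TFR t₀ x <;> simp [ht]
  simp_rw [this]
  rw [setIntegral_indicator (measurableSet_liveTimes _ _ _),
    Set.inter_eq_right.2 fun t ht => ht.1]

/-- Fubini on `fieldDomain`, whose slice at each `t > t₀` is the window `[t, t + TFR]`. -/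
lemma FiniteAction.energy_integrable {μ TFR t₀ : ℝ} (hT : 0 < TFR) {φ : ℝ → ℝ → ℝ}
    (hφ : FiniteAction TFR t₀ φ) :
    IntegrableOn (energy μ TFR φ) (Set.Ioi t₀) ∧
      ∀ᵐ t ∂volume.restrict (Set.Ioi t₀), IntervalIntegrable
        (fun y => φ t y ^ 2 + 1 / μ ^ 2 * deriv (φ t) y ^ 2) volume t (t + TFR) := by
  have h1 : IntegrableOn (fun p : ℝ × ℝ => φ p.1 p.2 ^ 2 + 1 / μ ^ 2 * deriv (φ p.1) p.2 ^ 2)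
      (fieldDomain TFR t₀) := hφ.memLp.integrable_sq.add (hφ.memLp_deriv.integrable_sq.const_mul _)
  have h2 := (integrable_indicator_iff (measurableSet_fieldDomain TFR t₀)).2 h1
  rw [Measure.volume_eq_prod] at h2
  have hs : ∀ t ∈ Set.Ioi t₀, (fun y => (fieldDomain TFR t₀).indicator
      (fun p : ℝ × ℝ => φ p.1 p.2 ^ 2 + 1 / μ ^ 2 * deriv (φ p.1) p.2 ^ 2) (t, y))
      = (Set.Icc t (t + TFR)).indicator
        (fun y => φ t y ^ 2 + 1 / μ ^ 2 * deriv (φ t) y ^ 2) := by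
    intro t ht
    ext y
    have : (t, y) ∈ fieldDomain TFR t₀ ↔ y ∈ Set.Icc t (t + TFR) := by
      simp only [fieldDomain, Set.mem_ofPred_eq, Set.mem_Icc, and_iff_right_iff_imp]
      exact fun _ => le_of_lt ht
    by_cases hy : y ∈ Set.Icc t (t + TFR)
    · rw [Set.indicator_of_mem hy, Set.indicator_of_mem (this.2 hy)]
    · rw [Set.indicator_of_notMem hy, Set.indicator_of_notMem (mt this.1 hy)]
  constructor
  · refine (h2.integral_prod_left.integrableOn (s := Set.Ioi t₀)).congr_fun ?_ measurableSet_Ioi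
    intro t ht
    change ∫ y, (fieldDomain TFR t₀).indicator _ (t, y) = _
    rw [hs t ht, integral_indicator measurableSet_Icc, energy,
      intervalIntegral.integral_of_le (by linarith), integral_Icc_eq_integral_Ioc]
  · rw [ae_restrict_iff' measurableSet_Ioi]
    filter_upwards [h2.prod_right_ae] with t ht htm
    rw [hs t htm, integrable_indicator_iff measurableSet_Icc] at ht
    exact (intervalIntegrable_iff_integrableOn_Icc_of_le (by linarith)).2 ht

lemma ae_restrict_liveTimes {TFR t₀ x : ℝ} {P : ℝ → Prop}
    (h : ∀ᵐ t ∂volume.restrict (Set.Ioi t₀), P t) :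
    ∀ᵐ t ∂volume.restrict (liveTimes TFR t₀ x), P t := by
  rw [restrict_Ioi_eq_restrict_Ici] at h
  exact ae_restrict_of_ae_restrict_of_subset (fun t ht => ht.1) h

/-- A trace estimate: evaluation at a maturity is controlled by the energy of the window, which is
integrable in time. This makes the coupling to square integrable sources finite. -/
lemma FiniteAction.memLp_eval {μ TFR t₀ x : ℝ} (hμ : μ ≠ 0) (hT : 0 < TFR) {φ : ℝ → ℝ → ℝ}
    (hφ : FiniteAction TFR t₀ φ) :
    MemLp (fun t => φ t x) 2 (volume.restrict (liveTimes TFR t₀ x)) := by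
  obtain ⟨hE, hI⟩ := hφ.energy_integrable (μ := μ) hT
  have hm : Measurable fun t => φ t x := hφ.measurable.comp (measurable_id.prodMk measurable_const)
  rw [memLp_two_iff_integrable_sq hm.aestronglyMeasurable]
  have hE' : Integrable (energy μ TFR φ) (volume.restrict (liveTimes TFR t₀ x)) := by
    rw [IntegrableOn, restrict_Ioi_eq_restrict_Ici] at hE
    exact IntegrableOn.mono_set hE fun t ht => ht.1
  refine (hE'.const_mul (greenBound μ TFR / TFR)).mono' (hm.pow_const 2).aestronglyMeasurable ?_
  filter_upwards [ae_restrict_liveTimes hI, ae_restrict_mem (measurableSet_liveTimes TFR t₀ x)]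
    with t ht hl
  rw [Real.norm_of_nonneg (sq_nonneg _)]
  exact sq_le_slice hμ hT hl.2.1 hl.2.2 (hφ.absolutelyContinuous t hl.1) ht

lemma FiniteAction.coupling_integrable {μ TFR t₀ x : ℝ} (hμ : μ ≠ 0) (hT : 0 < TFR)
    {φ : ℝ → ℝ → ℝ} (hφ : FiniteAction TFR t₀ φ) {h : ℝ → ℝ}
    (hh : MemLp h 2 (volume.restrict (liveTimes TFR t₀ x))) :
    IntegrableOn (fun t => (liveTimes TFR t₀ x).indicator h t * φ t x) (Set.Ioi t₀) := by
  have h1 : IntegrableOn (fun t => h t * φ t x) (liveTimes TFR t₀ x) :=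
    hh.integrable_mul (hφ.memLp_eval hμ hT)
  have h2 := ((integrable_indicator_iff (measurableSet_liveTimes TFR t₀ x)).2 h1).integrableOn
    (s := Set.Ioi t₀)
  refine h2.congr_fun (fun t _ => ?_) measurableSet_Ioi
  by_cases ht : t ∈ liveTimes TFR t₀ x <;> simp [ht]

/-- The configuration `h(t) D(x, y; t)`, supported on the times at which `x` is live. -/
def response (μ TFR t₀ x : ℝ) (h : ℝ → ℝ) (t y : ℝ) : ℝ :=
  (liveTimes TFR t₀ x).indicator h t * green μ TFR (y - t) (x - t)

lemma deriv_response (μ TFR t₀ x : ℝ) (h : ℝ → ℝ) (t y : ℝ) :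
    deriv (response μ TFR t₀ x h t) y = (liveTimes TFR t₀ x).indicator h t *
      deriv (fun z => green μ TFR (z - t) (x - t)) y :=
  deriv_const_mul_field _

/-- A function of `t` alone is square integrable here because the maturities are confined: if `x`
and `y` lie in the same window then `|y - x| ≤ TFR`, so a cutoff in `y` changes nothing. -/
lemma memLp_indicator_comp_fst {TFR t₀ x : ℝ} {h : ℝ → ℝ}
    (hh : MemLp h 2 (volume.restrict (liveTimes TFR t₀ x))) :
    MemLp (fun p : ℝ × ℝ => (liveTimes TFR t₀ x).indicator h p.1) 2
      (volume.restrict (fieldDomain TFR t₀)) := by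
  have h1 := (memLp_indicator_iff_restrict (measurableSet_liveTimes TFR t₀ x)).2 hh
  have h2 := h1.comp_fst (volume.restrict (Set.Icc (x - TFR) (x + TFR)))
  have h3 : (volume : Measure ℝ).prod (volume.restrict (Set.Icc (x - TFR) (x + TFR)))
      = (volume : Measure (ℝ × ℝ)).restrict (Set.univ ×ˢ Set.Icc (x - TFR) (x + TFR)) := by
    rw [Measure.volume_eq_prod, ← Measure.prod_restrict, Measure.restrict_univ]
  rw [h3, ← memLp_indicator_iff_restrict (MeasurableSet.univ.prod measurableSet_Icc)] at h2
  refine (h2.restrict (fieldDomain TFR t₀)).ae_eq ?_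
  filter_upwards [ae_restrict_mem (measurableSet_fieldDomain TFR t₀)] with p hp
  by_cases hl : p.1 ∈ liveTimes TFR t₀ x
  · have hq : p ∈ Set.univ ×ˢ Set.Icc (x - TFR) (x + TFR) := by
      obtain ⟨h1, h2, h3⟩ := hp
      obtain ⟨h4, h5, h6⟩ := hl
      exact ⟨trivial, by linarith, by linarith⟩
    rw [Set.indicator_of_mem hq]
  · by_cases hq : p ∈ Set.univ ×ˢ Set.Icc (x - TFR) (x + TFR)
    · rw [Set.indicator_of_mem hq]
    · rw [Set.indicator_of_notMem hq, Set.indicator_of_notMem hl]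

lemma continuous_green_sub (μ TFR x : ℝ) :
    Continuous fun p : ℝ × ℝ => green μ TFR (p.2 - p.1) (x - p.1) := by
  unfold green
  fun_prop

lemma measurable_deriv_green_sub (μ TFR x : ℝ) :
    Measurable fun p : ℝ × ℝ => deriv (fun z => green μ TFR (z - p.1) (x - p.1)) p.2 :=
  measurable_deriv_with_param (f := fun t z => green μ TFR (z - t) (x - t))
    (continuous_green_sub μ TFR x)

lemma measurable_indicator_liveTimes_fst {TFR t₀ x : ℝ} {h : ℝ → ℝ} (hm : Measurable h) :
    Measurable fun p : ℝ × ℝ => (liveTimes TFR t₀ x).indicator h p.1 :=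
  (hm.indicator (measurableSet_liveTimes TFR t₀ x)).comp measurable_fst

lemma measurable_response {μ TFR t₀ x : ℝ} {h : ℝ → ℝ} (hm : Measurable h) :
    Measurable fun p : ℝ × ℝ => response μ TFR t₀ x h p.1 p.2 := by
  unfold response
  exact (measurable_indicator_liveTimes_fst hm).mul (continuous_green_sub μ TFR x).measurable

lemma memLp_response {μ TFR t₀ x : ℝ} (hμ : μ ≠ 0) (hT : 0 < TFR) {h : ℝ → ℝ}
    (hm : Measurable h) (hh : MemLp h 2 (volume.restrict (liveTimes TFR t₀ x))) :
    MemLp (fun p : ℝ × ℝ => response μ TFR t₀ x h p.1 p.2) 2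
      (volume.restrict (fieldDomain TFR t₀)) := by
  refine (memLp_indicator_comp_fst hh).of_le_mul (c := greenBound μ TFR)
    (measurable_response hm).aestronglyMeasurable ?_
  filter_upwards [ae_restrict_mem (measurableSet_fieldDomain TFR t₀)] with p hp
  by_cases hl : p.1 ∈ liveTimes TFR t₀ x
  · have := green_le hμ hT (a := p.2 - p.1) (b := x - p.1)
      ⟨by linarith [hp.2.1], by linarith [hp.2.2]⟩ ⟨by linarith [hl.2.1], by linarith [hl.2.2]⟩
    rw [response, norm_mul, mul_comm, Real.norm_of_nonneg (green_pos hμ hT _ _).le]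
    gcongr
  · simp [response, hl]

lemma memLp_deriv_response {μ TFR t₀ x : ℝ} (hμ : μ ≠ 0) (hT : 0 < TFR) {h : ℝ → ℝ}
    (hm : Measurable h) (hh : MemLp h 2 (volume.restrict (liveTimes TFR t₀ x))) :
    MemLp (fun p : ℝ × ℝ => deriv (response μ TFR t₀ x h p.1) p.2) 2
      (volume.restrict (fieldDomain TFR t₀)) := by
  simp_rw [deriv_response]
  refine (memLp_indicator_comp_fst hh).of_le_mul (c := greenBound μ TFR * |μ|)
    ((measurable_indicator_liveTimes_fst hm).mul
      (measurable_deriv_green_sub μ TFR x)).aestronglyMeasurable ?_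
  -- The kinks of all the slices lie on the line `y = x`, which is null in the plane.
  have hae : ∀ᵐ p : ℝ × ℝ, p.2 ≠ x :=
    (Measure.quasiMeasurePreserving_snd (μ := (volume : Measure ℝ)) (ν := (volume : Measure ℝ))).ae
      (by simp [ae_iff] : ∀ᵐ y : ℝ, y ≠ x)
  filter_upwards [ae_restrict_mem (measurableSet_fieldDomain TFR t₀),
    ae_restrict_of_ae hae] with p hp hne
  by_cases hl : p.1 ∈ liveTimes TFR t₀ x
  · have := abs_deriv_green_le hμ hT (a := p.2 - p.1) (b := x - p.1)
      ⟨by linarith [hp.2.1], by linarith [hp.2.2]⟩ ⟨by linarith [hl.2.1], by linarith [hl.2.2]⟩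
      (fun h => hne (by linarith))
    rw [norm_mul, mul_comm, deriv_comp_sub_const (f := fun a => green μ TFR a (x - p.1)),
      Real.norm_eq_abs (deriv _ _)]
    gcongr
  · simp [hl]

lemma finiteAction_response {μ TFR t₀ x : ℝ} (hμ : μ ≠ 0) (hT : 0 < TFR) {h : ℝ → ℝ}
    (hm : Measurable h) (hh : MemLp h 2 (volume.restrict (liveTimes TFR t₀ x))) :
    FiniteAction TFR t₀ (response μ TFR t₀ x h) := by
  refine ⟨measurable_response hm, fun t _ => ?_, memLp_response hμ hT hm hh,
    memLp_deriv_response hμ hT hm hh⟩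
  by_cases hl : t ∈ liveTimes TFR t₀ x
  · exact (absolutelyContinuousOnInterval_green μ TFR (x - t) t hT
      ⟨by linarith [hl.2.1], by linarith [hl.2.2]⟩).const_mul _
  · have : response μ TFR t₀ x h t = fun _ => 0 := by
      ext y; simp [response, hl]
    rw [this]
    exact contDiff_const.contDiffOn.absolutelyContinuousOnInterval

/-- The exponent decouples in `t`, so the maximum is taken window by window: `slice_le` with `c = h
t` at live times, with equality for the Green function by `slice_green`. At other times the source
vanishes and zero is optimal. -/
lemma isResponse_response {μ TFR t₀ x : ℝ} (hμ : μ ≠ 0) (hT : 0 < TFR) {h : ℝ → ℝ}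
    (hm : Measurable h) (hh : MemLp h 2 (volume.restrict (liveTimes TFR t₀ x))) :
    IsResponse μ TFR t₀ x h (response μ TFR t₀ x h) := by
  have hu := finiteAction_response hμ hT hm hh
  refine ⟨hu, fun φ hφ => ?_⟩
  obtain ⟨hE, hI⟩ := hφ.energy_integrable (μ := μ) hT
  obtain ⟨hEu, -⟩ := hu.energy_integrable (μ := μ) hT
  rw [coupling_eq, coupling_eq, action_eq, action_eq,
    ← integral_add (hφ.coupling_integrable hμ hT hh) (hE.const_mul _),
    ← integral_add (hu.coupling_integrable hμ hT hh) (hEu.const_mul _)]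
  refine integral_mono_ae ((hφ.coupling_integrable hμ hT hh).add (hE.const_mul _))
    ((hu.coupling_integrable hμ hT hh).add (hEu.const_mul _)) ?_
  filter_upwards [hI, ae_restrict_mem measurableSet_Ioi] with t ht ht0
  change _ * φ t x + -(1 / (2 * TFR)) * energy μ TFR φ t
    ≤ _ * response μ TFR t₀ x h t x + -(1 / (2 * TFR)) * energy μ TFR (response μ TFR t₀ x h) t
  have hu' : energy μ TFR (response μ TFR t₀ x h) t
      = (liveTimes TFR t₀ x).indicator h t ^ 2 * ∫ y in t..(t + TFR),
        (green μ TFR (y - t) (x - t) ^ 2 + 1 / μ ^ 2 *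
          deriv (fun z => green μ TFR (z - t) (x - t)) y ^ 2) := by
    rw [energy, ← intervalIntegral.integral_const_mul]
    congr 1
    ext y
    rw [deriv_response, response]
    ring
  rw [hu']
  by_cases hl : t ∈ liveTimes TFR t₀ x
  · rw [slice_green hμ hT hl.2.1 hl.2.2, response, Set.indicator_of_mem hl]
    have := slice_le hμ hT hl.2.1 hl.2.2 (hφ.absolutelyContinuous t hl.1) ht (h t)
    change 2 * h t * φ t x * TFR - energy μ TFR φ t ≤ _ at this
    have h2 : (2 * h t * φ t x * TFR - energy μ TFR φ t) / (2 * TFR)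
      ≤ (h t ^ 2 * TFR * green μ TFR (x - t) (x - t)) / (2 * TFR) := by gcongr
    calc h t * φ t x + -(1 / (2 * TFR)) * energy μ TFR φ t
        = (2 * h t * φ t x * TFR - energy μ TFR φ t) / (2 * TFR) := by field_simp; ring
      _ ≤ _ := h2
      _ = _ := by field_simp; ring
  · have hnn : 0 ≤ energy μ TFR φ t :=
      intervalIntegral.integral_nonneg (by linarith) fun y _ => by positivity
    simp only [Set.indicator_of_notMem hl, zero_mul, zero_add]
    have : 0 ≤ 1 / (2 * TFR) * energy μ TFR φ t := by positivity
    nlinarith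

/-! ### Covariances of the field smeared with the volatility -/

/-- The source that produces the noise accumulated by the forward rate of maturity `x` up to
time `t`. -/
def rateSource (σ : ℝ → ℝ → ℝ) (t₀ t x : ℝ) : ℝ → ℝ :=
  Set.indicator (Set.Icc t₀ t) (fun s => σ s x)

lemma measurable_rateSource {σ : ℝ → ℝ → ℝ} (hσ : Measurable (Function.uncurry σ)) (t₀ t x : ℝ) :
    Measurable (rateSource σ t₀ t x) :=
  (hσ.comp (measurable_id.prodMk measurable_const)).indicator measurableSet_Icc

lemma rateSource_mem {σ : ℝ → ℝ → ℝ} {TFR t₀ t x C : ℝ} (hσ : Measurable (Function.uncurry σ))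
    (hC : ∀ p ∈ rateDomain TFR t₀, |σ p.1 p.2| ≤ C) (hx : (t, x) ∈ rateDomain TFR t₀) :
    (x, rateSource σ t₀ t x) ∈ sources TFR t₀ := by
  change MemLp (rateSource σ t₀ t x) 2 (volume.restrict (liveTimes TFR t₀ x))
  rw [liveTimes_eq_Icc]
  refine MemLp.of_bound (measurable_rateSource hσ t₀ t x).aestronglyMeasurable C ?_
  refine Filter.Eventually.of_forall fun s => ?_
  by_cases hs : s ∈ Set.Icc t₀ t
  · rw [rateSource, Set.indicator_of_mem hs]
    exact hC (s, x) ⟨hs.1, hs.2.trans hx.2.1, hx.2.2⟩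
  · rw [rateSource, Set.indicator_of_notMem hs, norm_zero]
    exact (abs_nonneg _).trans (hC _ hx)

/-- The explicit response is a legitimate input to the covariance property. Since it is local in
time, only times common to both sources contribute, hence the upper limit `min t t'`. -/
lemma IsActionField.covariance_rateSource {Ω : Type*} [MeasurableSpace Ω] {Q : Measure Ω}
    {μ TFR t₀ C : ℝ} (hμ : μ ≠ 0) (hT : 0 < TFR) {A : ℝ → (ℝ → ℝ) → Ω → ℝ}
    (hA : IsActionField Q μ TFR t₀ A) {σ : ℝ → ℝ → ℝ} (hσ : Measurable (Function.uncurry σ))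
    (hC : ∀ p ∈ rateDomain TFR t₀, |σ p.1 p.2| ≤ C) {t x t' x' : ℝ}
    (hx : (t, x) ∈ rateDomain TFR t₀) (hx' : (t', x') ∈ rateDomain TFR t₀) :
    cov[A x (rateSource σ t₀ t x), A x' (rateSource σ t₀ t' x'); Q]
      = ∫ s in t₀..min t t', σ s x * σ s x' * green μ TFR (x - s) (x' - s) := by
  have hp := rateSource_mem hσ hC hx
  have hp' := rateSource_mem hσ hC hx'
  rw [hA.covariance _ hp _ hp' _ (isResponse_response hμ hT (measurable_rateSource hσ t₀ t x) hp)]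
  obtain ⟨h1, h2, h3⟩ := hx
  obtain ⟨h1', h2', h3'⟩ := hx'
  simp only at h1 h2 h3 h1' h2' h3'
  rw [coupling, intervalIntegral.integral_of_le (le_min h1 h1'), ← integral_Icc_eq_integral_Ioc,
    ← integral_indicator measurableSet_Icc, ← integral_indicator (measurableSet_liveTimes _ _ _)]
  congr 1
  ext s
  by_cases hs : s ∈ Set.Icc t₀ (min t t')
  · have ht : s ∈ Set.Icc t₀ t := ⟨hs.1, hs.2.trans (min_le_left _ _)⟩
    have ht' : s ∈ Set.Icc t₀ t' := ⟨hs.1, hs.2.trans (min_le_right _ _)⟩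
    have hl : s ∈ liveTimes TFR t₀ x := ⟨hs.1, ht.2.trans h2, by linarith [hs.1]⟩
    have hl' : s ∈ liveTimes TFR t₀ x' := ⟨hs.1, ht'.2.trans h2', by linarith [hs.1]⟩
    simp only [Set.indicator_of_mem, hs, ht, ht', hl, hl', response, rateSource]
    rw [green_comm μ TFR (x' - s)]
    ring
  · rw [Set.indicator_of_notMem hs]
    by_cases hl' : s ∈ liveTimes TFR t₀ x'
    · rw [Set.indicator_of_mem hl', response]
      by_cases ht : s ∈ Set.Icc t₀ t
      · have ht' : s ∉ Set.Icc t₀ t' := fun h => hs ⟨h.1, le_min ht.2 h.2⟩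
        simp [rateSource, Set.indicator_of_notMem ht']
      · by_cases hl : s ∈ liveTimes TFR t₀ x <;>
          simp [rateSource, Set.indicator_of_notMem ht, hl]
    · rw [Set.indicator_of_notMem hl']

/-! ### The Gaussian Hilbert space of a centred Gaussian process -/

section GaussianHilbert

variable {Ω : Type*} [MeasurableSpace Ω] {Q : Measure Ω}

lemma norm_cexp_mul_I_sub_le (a b : ℝ) :
    ‖Complex.exp (a * Complex.I) - Complex.exp (b * Complex.I)‖ ≤ |a - b| := by
  have h : Complex.exp (a * Complex.I) - Complex.exp (b * Complex.I)
      = Complex.exp (b * Complex.I) * (Complex.exp (Complex.I * ((a - b : ℝ) : ℂ)) - 1) := by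
    rw [mul_sub, ← Complex.exp_add, mul_one]
    congr 2
    push_cast
    ring
  rw [h, norm_mul, Complex.norm_exp_ofReal_mul_I, one_mul]
  exact Real.norm_exp_I_mul_ofReal_sub_one_le

lemma integrable_cexp_mul_I [IsFiniteMeasure Q] {Y : Ω → ℝ} (hY : AEStronglyMeasurable Y Q) :
    Integrable (fun ω => Complex.exp (Y ω * Complex.I)) Q := by
  refine Integrable.of_bound (C := 1) ?_ (Filter.Eventually.of_forall fun ω => ?_)
  · exact (by fun_prop : Continuous fun x : ℝ =>
      Complex.exp (x * Complex.I)).comp_aestronglyMeasurable hY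
  · rw [Complex.norm_exp_ofReal_mul_I]

lemma integral_abs_le_norm [IsProbabilityMeasure Q] (v : Lp ℝ 2 Q) : ∫ ω, |v ω| ∂Q ≤ ‖v‖ := by
  have h : ∫ ω, |v ω| ∂Q = (eLpNorm v 1 Q).toReal := by
    rw [eLpNorm_one_eq_lintegral_enorm, ← integral_norm_eq_lintegral_enorm
      (Lp.aestronglyMeasurable v)]
    rfl
  rw [h, Lp.norm_def]
  exact ENNReal.toReal_mono (Lp.eLpNorm_ne_top v)
    (eLpNorm_le_eLpNorm_of_exponent_le (by norm_num) (Lp.aestronglyMeasurable v))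

/-- Since `x ↦ exp(ix)` is 1-Lipschitz and the `L¹` norm is at most the `L²` norm, the map is
Lipschitz with constant `|t|`. This carries the Gaussian characteristic function from the span to
its closure. -/
lemma continuous_integral_cexp [IsProbabilityMeasure Q] (t : ℝ) :
    Continuous fun v : Lp ℝ 2 Q => ∫ ω, Complex.exp ((t * v ω : ℝ) * Complex.I) ∂Q := by
  refine (LipschitzWith.of_dist_le_mul (K := ⟨|t|, abs_nonneg t⟩) fun v w => ?_).continuous
  have hv := integrable_cexp_mul_I ((Lp.aestronglyMeasurable v).const_mul t)
  have hw := integrable_cexp_mul_I ((Lp.aestronglyMeasurable w).const_mul t)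
  rw [dist_eq_norm, dist_eq_norm, ← integral_sub hv hw]
  have hint : Integrable (fun ω => |(v - w : Lp ℝ 2 Q) ω|) Q :=
    ((Lp.memLp (v - w)).integrable (by norm_num)).abs
  calc _ ≤ ∫ ω, |t| * |(v - w : Lp ℝ 2 Q) ω| ∂Q := by
        refine norm_integral_le_of_norm_le (hint.const_mul _) ?_
        filter_upwards [Lp.coeFn_sub v w] with ω hω
        rw [hω, Pi.sub_apply, ← abs_mul, mul_sub]
        exact norm_cexp_mul_I_sub_le _ _
    _ = |t| * ∫ ω, |(v - w : Lp ℝ 2 Q) ω| ∂Q := integral_const_mul _ _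
    _ ≤ |t| * ‖v - w‖ := by gcongr; exact integral_abs_le_norm _

lemma norm_sq_eq_integral (v : Lp ℝ 2 Q) : ‖v‖ ^ 2 = ∫ ω, v ω ^ 2 ∂Q := by
  rw [← real_inner_self_eq_norm_sq, L2.inner_def]
  simp [pow_two]

/-- The closed linear span in `L²` of a family of random variables. -/
def closedSpan {ι : Type*} {X : ι → Ω → ℝ} (hX : ∀ i, MemLp (X i) 2 Q) : Submodule ℝ (Lp ℝ 2 Q) :=
  (Submodule.span ℝ (Set.range fun i => (hX i).toLp)).topologicalClosure

lemma integral_cexp_of_mem_span [IsProbabilityMeasure Q] {ι : Type*} {X : ι → Ω → ℝ}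
    (hX : ∀ i, MemLp (X i) 2 Q) (hg : IsGaussianProcess X Q) (h0 : ∀ i, ∫ ω, X i ω ∂Q = 0)
    {v : Lp ℝ 2 Q} (hv : v ∈ Submodule.span ℝ (Set.range fun i => (hX i).toLp)) (t : ℝ) :
    ∫ ω, Complex.exp ((t * v ω : ℝ) * Complex.I) ∂Q
      = Complex.exp (-(‖v‖ ^ 2 * t ^ 2 / 2 : ℝ)) := by
  obtain ⟨c, rfl⟩ := Finsupp.mem_span_range_iff_exists_finsupp.1 hv
  set v := c.sum fun i a => a • (hX i).toLp with hvdef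
  have hae : v =ᵐ[Q] fun ω => ∑ i ∈ c.support, c i • X i ω := by
    have h1 : ∀ᵐ ω ∂Q, ∀ i ∈ c.support, (c i • (hX i).toLp : Lp ℝ 2 Q) ω = c i • X i ω := by
      rw [Filter.eventually_all_finset]
      intro i _
      filter_upwards [Lp.coeFn_smul (c i) (hX i).toLp, (hX i).coeFn_toLp] with ω h2 h3
      rw [h2, Pi.smul_apply, h3]
    filter_upwards [Lp.coeFn_finsetSum c.support fun i => c i • (hX i).toLp, h1] with ω h2 h3
    rw [hvdef, Finsupp.sum, h2, Finset.sum_apply]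
    exact Finset.sum_congr rfl h3
  have hlaw : HasGaussianLaw v Q :=
    ((hg.smul c).hasGaussianLaw_fun_sum (I := c.support)).congr hae.symm
  have hmean : ∫ ω, v ω ∂Q = 0 := by
    have hi : ∀ i ∈ c.support, Integrable (fun ω => c i • X i ω) Q := fun i _ =>
      ((hX i).integrable (by norm_num)).smul (c i)
    rw [integral_congr_ae hae, integral_finsetSum _ hi]
    simp [integral_const_mul, h0]
  have hvar : Var[v; Q] = ‖v‖ ^ 2 := by
    rw [variance_of_integral_eq_zero hlaw.aemeasurable hmean, norm_sq_eq_integral]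
  have hcf : charFun (Q.map v) t = ∫ ω, Complex.exp ((t * v ω : ℝ) * Complex.I) ∂Q := by
    rw [charFun_apply_real, integral_map hlaw.aemeasurable (by fun_prop)]
    simp
  rw [← hcf, hlaw.map_eq_gaussianReal, charFun_gaussianReal, hmean, hvar,
    Real.coe_toNNReal _ (by positivity)]
  push_cast
  ring_nf

lemma integral_cexp_of_mem_closedSpan [IsProbabilityMeasure Q] {ι : Type*} {X : ι → Ω → ℝ}
    (hX : ∀ i, MemLp (X i) 2 Q) (hg : IsGaussianProcess X Q) (h0 : ∀ i, ∫ ω, X i ω ∂Q = 0)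
    {v : Lp ℝ 2 Q} (hv : v ∈ closedSpan hX) (t : ℝ) :
    ∫ ω, Complex.exp ((t * v ω : ℝ) * Complex.I) ∂Q
      = Complex.exp (-(‖v‖ ^ 2 * t ^ 2 / 2 : ℝ)) := by
  have hclosed : IsClosed {v : Lp ℝ 2 Q | ∫ ω, Complex.exp ((t * v ω : ℝ) * Complex.I) ∂Q
      = Complex.exp (-(‖v‖ ^ 2 * t ^ 2 / 2 : ℝ))} :=
    isClosed_eq (continuous_integral_cexp t) (by fun_prop)
  exact closure_minimal (fun w hw => integral_cexp_of_mem_span hX hg h0 hw t) hclosed hv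

/-- Elements of the closed linear span of a centred Gaussian process are centred Gaussian. -/
lemma map_eq_gaussianReal_of_mem_closedSpan [IsProbabilityMeasure Q] {ι : Type*} {X : ι → Ω → ℝ}
    (hX : ∀ i, MemLp (X i) 2 Q) (hg : IsGaussianProcess X Q) (h0 : ∀ i, ∫ ω, X i ω ∂Q = 0)
    {v : Lp ℝ 2 Q} (hv : v ∈ closedSpan hX) :
    Q.map v = gaussianReal 0 (‖v‖ ^ 2).toNNReal := by
  have hm : AEMeasurable v Q := (Lp.aestronglyMeasurable v).aemeasurable
  have : IsProbabilityMeasure (Q.map v) := Measure.isProbabilityMeasure_map hm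
  refine Measure.ext_of_charFun (funext fun t => ?_)
  have hcf : charFun (Q.map v) t = ∫ ω, Complex.exp ((t * v ω : ℝ) * Complex.I) ∂Q := by
    rw [charFun_apply_real, integral_map hm (by fun_prop)]
    simp
  rw [hcf, integral_cexp_of_mem_closedSpan hX hg h0 hv, charFun_gaussianReal,
    Real.coe_toNNReal _ (by positivity)]
  push_cast
  ring_nf

/-- The moment generating function of a centred Gaussian at `-1`. The variable is given only up to
almost sure equality so that pathwise integrals qualify. -/
lemma integral_exp_neg_of_mem_closedSpan [IsProbabilityMeasure Q] {ι : Type*} {X : ι → Ω → ℝ}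
    (hX : ∀ i, MemLp (X i) 2 Q) (hg : IsGaussianProcess X Q) (h0 : ∀ i, ∫ ω, X i ω ∂Q = 0)
    {Y : Ω → ℝ} (hY : ∃ v ∈ closedSpan hX, v =ᵐ[Q] Y) :
    Integrable (fun ω => Real.exp (-Y ω)) Q ∧
      ∫ ω, Real.exp (-Y ω) ∂Q = Real.exp ((∫ ω, Y ω ^ 2 ∂Q) / 2) := by
  obtain ⟨v, hv, hvY⟩ := hY
  have hm : AEMeasurable v Q := (Lp.aestronglyMeasurable v).aemeasurable
  have hmap := map_eq_gaussianReal_of_mem_closedSpan hX hg h0 hv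
  have hexp : (fun ω => Real.exp (-1 * v ω)) =ᵐ[Q] fun ω => Real.exp (-Y ω) := by
    filter_upwards [hvY] with ω h
    rw [h, neg_one_mul]
  constructor
  · have h1 : Integrable (fun x => Real.exp (-1 * x)) (Q.map v) := by
      rw [hmap]; exact integrable_exp_mul_gaussianReal (-1)
    exact ((integrable_map_measure (by fun_prop) hm).1 h1).congr hexp
  · have h2 : ∫ ω, Y ω ^ 2 ∂Q = ‖v‖ ^ 2 := by
      rw [norm_sq_eq_integral]
      refine integral_congr_ae ?_
      filter_upwards [hvY] with ω h
      rw [h]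
    have h3 := mgf_gaussianReal hmap (-1)
    rw [mgf, integral_congr_ae hexp] at h3
    rw [h3, h2, Real.coe_toNNReal _ (by positivity)]
    ring_nf

/-! ### Integrals of random fields -/

/-- Cauchy–Schwarz against the constant 1, read off from the discriminant of the nonnegative
quadratic `c ↦ ∫ (g - c)²`. -/
lemma sq_integral_le {X : Type*} [MeasurableSpace X] {ν : Measure X} [IsFiniteMeasure ν]
    {g : X → ℝ} (hg : MemLp g 2 ν) : (∫ x, g x ∂ν) ^ 2 ≤ ν.real Set.univ * ∫ x, g x ^ 2 ∂ν := by
  have h1 := hg.integrable (by norm_num : (1 : ENNReal) ≤ 2)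
  have h2 := hg.integrable_sq
  have h := discrim_le_zero (a := ν.real Set.univ) (b := -(2 * ∫ x, g x ∂ν))
    (c := ∫ x, g x ^ 2 ∂ν) fun c => by
      have hnn : 0 ≤ ∫ x, (g x - c) ^ 2 ∂ν := integral_nonneg fun x => sq_nonneg _
      have he : ∫ x, (g x - c) ^ 2 ∂ν
          = ∫ x, g x ^ 2 ∂ν - 2 * c * ∫ x, g x ∂ν + c ^ 2 * ν.real Set.univ := by
        have : ∀ x, (g x - c) ^ 2 = g x ^ 2 - 2 * c * g x + c ^ 2 := fun x => by ring
        simp_rw [this]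
        have h3 : Integrable (fun x => g x ^ 2 - 2 * c * g x) ν := h2.sub (h1.const_mul _)
        rw [integral_add h3 (integrable_const _),
          integral_sub h2 (h1.const_mul _), integral_const_mul, integral_const, smul_eq_mul,
          mul_comm (c ^ 2)]
      linarith [he]
  rw [discrim] at h
  linarith

variable [IsProbabilityMeasure Q] {X : Type*} [MeasurableSpace X] {ν : Measure X}
  [IsFiniteMeasure ν] {F : X → Ω → ℝ}

lemma memLp_integral_left (hF : MemLp (Function.uncurry F) 2 (ν.prod Q)) :
    MemLp (fun ω => ∫ x, F x ω ∂ν) 2 Q := by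
  have hm : AEStronglyMeasurable (fun ω => ∫ x, F x ω ∂ν) Q :=
    hF.1.prod_swap.integral_prod_right'
  rw [memLp_two_iff_integrable_sq hm]
  have hsq := hF.integrable_sq
  have hb : Integrable (fun ω => ∫ x, F x ω ^ 2 ∂ν) Q := hsq.integral_prod_right
  refine (hb.const_mul (ν.real Set.univ)).mono' (hm.pow 2) ?_
  filter_upwards [hsq.prod_left_ae, hF.1.prod_swap.prodMk_left] with ω h1 h2
  rw [Real.norm_of_nonneg (sq_nonneg _)]
  exact sq_integral_le ((memLp_two_iff_integrable_sq h2).2 h1)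

lemma integral_mul_integral (hF : MemLp (Function.uncurry F) 2 (ν.prod Q)) {Z : Ω → ℝ}
    (hZ : MemLp Z 2 Q) :
    ∫ ω, Z ω * ∫ x, F x ω ∂ν ∂Q = ∫ x, ∫ ω, Z ω * F x ω ∂Q ∂ν := by
  have h : Integrable (fun p : X × Ω => Z p.2 * F p.1 p.2) (ν.prod Q) :=
    (hZ.comp_snd ν).integrable_mul hF
  simp_rw [← integral_const_mul]
  exact (integral_integral_swap h).symm

/-- A closed subspace is its own double orthogonal complement. If `z` is orthogonal to `V`, Fubini
moves the pairing with `z` inside the integral over `x`, where it vanishes for almost every `x`. -/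
lemma exists_mem_closedSubmodule_integral (hF : MemLp (Function.uncurry F) 2 (ν.prod Q))
    {V : Submodule ℝ (Lp ℝ 2 Q)} (hV : IsClosed (V : Set (Lp ℝ 2 Q)))
    (hFV : ∀ᵐ x ∂ν, ∃ v ∈ V, v =ᵐ[Q] F x) : ∃ v ∈ V, v =ᵐ[Q] fun ω => ∫ x, F x ω ∂ν := by
  have hG := memLp_integral_left hF
  refine ⟨hG.toLp, ?_, hG.coeFn_toLp⟩
  have : CompleteSpace V := hV.completeSpace_coe
  rw [← V.orthogonal_orthogonal, Submodule.mem_orthogonal]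
  intro z hz
  rw [L2.inner_def]
  have h1 : ∫ ω, inner ℝ (z ω) ((hG.toLp : Lp ℝ 2 Q) ω) ∂Q = ∫ ω, z ω * ∫ x, F x ω ∂ν ∂Q := by
    refine integral_congr_ae ?_
    filter_upwards [hG.coeFn_toLp] with ω h
    rw [h]
    simp [mul_comm]
  rw [h1, integral_mul_integral hF (Lp.memLp z)]
  refine (integral_congr_ae (g := fun _ => (0 : ℝ)) ?_).trans (by simp)
  filter_upwards [hFV] with x ⟨v, hv, hvx⟩
  have h2 := (Submodule.mem_orthogonal V z).1 hz v hv
  rw [L2.inner_def] at h2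
  rw [← h2]
  refine integral_congr_ae ?_
  filter_upwards [hvx] with ω h
  rw [h]
  simp

/-- A random field with bounded second moments is square integrable on the product space. -/
lemma memLp_uncurry_of_sq_le (hm : AEStronglyMeasurable (Function.uncurry F) (ν.prod Q)) {K : ℝ}
    (hF : ∀ᵐ x ∂ν, MemLp (F x) 2 Q ∧ ∫ ω, F x ω ^ 2 ∂Q ≤ K) :
    MemLp (Function.uncurry F) 2 (ν.prod Q) := by
  have hm2 : AEStronglyMeasurable (fun p : X × Ω => Function.uncurry F p ^ 2) (ν.prod Q) := hm.pow 2
  rw [memLp_two_iff_integrable_sq hm, integrable_prod_iff hm2]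
  constructor
  · filter_upwards [hF] with x hx
    exact hx.1.integrable_sq
  · refine Integrable.of_bound (C := K) hm2.norm.integral_prod_right' ?_
    filter_upwards [hF] with x hx
    have : ∀ ω, ‖Function.uncurry F (x, ω) ^ 2‖ = F x ω ^ 2 := fun ω =>
      Real.norm_of_nonneg (sq_nonneg _)
    simp only [this]
    rw [Real.norm_of_nonneg (integral_nonneg fun ω => sq_nonneg _)]
    exact hx.2

end GaussianHilbert

/-! ### The futures exponent as an iterated integral of covariances -/

lemma integral_rotate {ν₁ ν₂ ν₃ : Measure ℝ} [IsFiniteMeasure ν₁] [IsFiniteMeasure ν₂]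
    [IsFiniteMeasure ν₃] {g : ℝ × ℝ × ℝ → ℝ} (hg : Measurable g) {M : ℝ} (hM : ∀ p, ‖g p‖ ≤ M) :
    ∫ x, ∫ y, ∫ s, g (s, x, y) ∂ν₃ ∂ν₂ ∂ν₁ = ∫ s, ∫ x, ∫ y, g (s, x, y) ∂ν₂ ∂ν₁ ∂ν₃ := by
  have h1 : ∀ x, ∫ y, ∫ s, g (s, x, y) ∂ν₃ ∂ν₂ = ∫ s, ∫ y, g (s, x, y) ∂ν₂ ∂ν₃ := fun x => by
    refine integral_integral_swap (f := fun y s => g (s, x, y)) (Integrable.of_bound (C := M) ?_ ?_)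
    · exact (hg.comp (measurable_snd.prodMk
        (measurable_const.prodMk measurable_fst))).aestronglyMeasurable
    · exact Filter.Eventually.of_forall fun p => hM _
  simp_rw [h1]
  refine integral_integral_swap (f := fun x s => ∫ y, g (s, x, y) ∂ν₂)
    (Integrable.of_bound (C := M * ν₂.real Set.univ) ?_ ?_)
  · have : Measurable fun q : (ℝ × ℝ) × ℝ => g (q.1.2, q.1.1, q.2) :=
      hg.comp ((measurable_snd.comp measurable_fst).prodMk
        ((measurable_fst.comp measurable_fst).prodMk measurable_snd))
    exact this.stronglyMeasurable.integral_prod_right'.aestronglyMeasurable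
  · exact Filter.Eventually.of_forall fun p =>
      norm_integral_le_of_norm_le_const (Filter.Eventually.of_forall fun y => hM _)

/-- The region of integration of the futures exponent. -/
def exponentDomain (t₀ ts T : ℝ) : Set (ℝ × ℝ × ℝ) :=
  {p | t₀ ≤ p.1 ∧ p.1 ≤ p.2.1 ∧ p.2.1 ≤ ts ∧ ts ≤ p.2.2 ∧ p.2.2 ≤ T}

lemma measurableSet_exponentDomain (t₀ ts T : ℝ) : MeasurableSet (exponentDomain t₀ ts T) := by
  have hx : Measurable fun p : ℝ × ℝ × ℝ => p.2.1 := measurable_fst.comp measurable_snd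
  have hy : Measurable fun p : ℝ × ℝ × ℝ => p.2.2 := measurable_snd.comp measurable_snd
  simp only [exponentDomain, Set.ofPred_and]
  exact (measurableSet_le measurable_const measurable_fst).inter
    ((measurableSet_le measurable_fst hx).inter ((measurableSet_le hx measurable_const).inter
      ((measurableSet_le measurable_const hy).inter (measurableSet_le hy measurable_const))))

/-- The covariance density of the rates of maturities `x` and `x'` at time `s`. -/
def covarianceDensity (μ TFR : ℝ) (σ : ℝ → ℝ → ℝ) (s x x' : ℝ) : ℝ :=
  σ s x * σ s x' * green μ TFR (x - s) (x' - s)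

lemma abs_covarianceDensity_le {μ TFR t₀ C s x x' : ℝ} (hμ : μ ≠ 0) (hT : 0 < TFR)
    {σ : ℝ → ℝ → ℝ} (hC : ∀ p ∈ rateDomain TFR t₀, |σ p.1 p.2| ≤ C)
    (hx : (s, x) ∈ rateDomain TFR t₀) (hx' : (s, x') ∈ rateDomain TFR t₀) :
    |covarianceDensity μ TFR σ s x x'| ≤ C * C * greenBound μ TFR := by
  have h1 := hC _ hx
  have h2 := hC _ hx'
  obtain ⟨a1, a2, a3⟩ := hx
  obtain ⟨b1, b2, b3⟩ := hx'
  simp only at h1 h2 a1 a2 a3 b1 b2 b3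
  have h3 := green_le hμ hT (a := x - s) (b := x' - s) ⟨by linarith, by linarith⟩
    ⟨by linarith, by linarith⟩
  have h4 : 0 ≤ C := (abs_nonneg _).trans h1
  have h5 := green_pos hμ hT (x - s) (x' - s)
  rw [covarianceDensity, abs_mul, abs_mul, abs_of_pos h5]
  gcongr

lemma measurable_covarianceDensity (μ TFR : ℝ) {σ : ℝ → ℝ → ℝ}
    (hσ : Measurable (Function.uncurry σ)) :
    Measurable fun p : ℝ × ℝ × ℝ => covarianceDensity μ TFR σ p.1 p.2.1 p.2.2 := by
  have hx : Measurable fun p : ℝ × ℝ × ℝ => p.2.1 := measurable_fst.comp measurable_snd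
  have hy : Measurable fun p : ℝ × ℝ × ℝ => p.2.2 := measurable_snd.comp measurable_snd
  have h1 : Measurable fun p : ℝ × ℝ × ℝ => σ p.1 p.2.1 := hσ.comp (measurable_fst.prodMk hx)
  have h2 : Measurable fun p : ℝ × ℝ × ℝ => σ p.1 p.2.2 := hσ.comp (measurable_fst.prodMk hy)
  have h3 : Measurable fun p : ℝ × ℝ × ℝ => green μ TFR (p.2.1 - p.1) (p.2.2 - p.1) := by
    unfold green
    fun_prop
  exact (h1.mul h2).mul h3

/-- The two sides are iterated integrals over one region in different orders. Extending the
integrand by zero off `exponentDomain` makes all the limits constant, and boundedness then justifies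
Fubini. -/
lemma neg_futuresExponent_eq {μ TFR t₀ ts T C : ℝ} (hμ : μ ≠ 0) (hTFR : 0 < TFR)
    (h₀ : t₀ ≤ ts) (h₁ : ts ≤ T) (h₂ : T ≤ t₀ + TFR)
    {σ : ℝ → ℝ → ℝ} (hσ : Measurable (Function.uncurry σ))
    (hC : ∀ p ∈ rateDomain TFR t₀, |σ p.1 p.2| ≤ C) :
    ∫ x in Set.Ioc t₀ ts, ∫ x' in Set.Ioc ts T, ∫ s in t₀..x, covarianceDensity μ TFR σ s x x'
      = -futuresExponent μ TFR σ t₀ ts T := by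
  set S := exponentDomain t₀ ts T
  set g : ℝ × ℝ × ℝ → ℝ :=
    S.indicator fun p => covarianceDensity μ TFR σ p.1 p.2.1 p.2.2 with hg
  have hgm : Measurable g :=
    (measurable_covarianceDensity μ TFR hσ).indicator (measurableSet_exponentDomain t₀ ts T)
  have hgM : ∀ p, ‖g p‖ ≤ C * C * greenBound μ TFR := by
    intro p
    by_cases hp : p ∈ S
    · rw [hg, Set.indicator_of_mem hp]
      obtain ⟨p1, p2, p3, p4, p5⟩ := hp
      exact abs_covarianceDensity_le (t₀ := t₀) hμ hTFR hC
        ⟨p1, p2, p3.trans (h₁.trans h₂)⟩ ⟨p1, p2.trans (p3.trans p4), p5.trans h₂⟩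
    · rw [hg, Set.indicator_of_notMem hp, norm_zero]
      have := greenBound_pos hμ hTFR
      have := mul_self_nonneg C
      positivity
  have hL : ∫ x in Set.Ioc t₀ ts, ∫ x' in Set.Ioc ts T,
        ∫ s in t₀..x, covarianceDensity μ TFR σ s x x'
      = ∫ x in Set.Ioc t₀ ts, ∫ x' in Set.Ioc ts T, ∫ s in Set.Ioc t₀ ts, g (s, x, x') := by
    refine setIntegral_congr_fun measurableSet_Ioc fun x hx => ?_
    refine setIntegral_congr_fun measurableSet_Ioc fun x' hx' => ?_
    rw [intervalIntegral.integral_of_le hx.1.le, ← integral_indicator measurableSet_Ioc,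
      ← integral_indicator measurableSet_Ioc]
    congr 1
    ext s
    by_cases hs : s ∈ Set.Ioc t₀ x
    · rw [Set.indicator_of_mem hs,
        Set.indicator_of_mem (show s ∈ Set.Ioc t₀ ts from ⟨hs.1, hs.2.trans hx.2⟩), hg,
        Set.indicator_of_mem]
      exact ⟨hs.1.le, hs.2, hx.2, hx'.1.le, hx'.2⟩
    · rw [Set.indicator_of_notMem hs]
      by_cases hs' : s ∈ Set.Ioc t₀ ts
      · rw [Set.indicator_of_mem hs', hg, Set.indicator_of_notMem]
        exact fun h => hs ⟨hs'.1, h.2.1⟩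
      · rw [Set.indicator_of_notMem hs']
  rw [hL, integral_rotate hgm hgM, futuresExponent, neg_neg, intervalIntegral.integral_of_le h₀]
  refine setIntegral_congr_fun measurableSet_Ioc fun s hs => ?_
  -- The region includes `x = s`, so the interval is closed at that null endpoint to let the
  -- integrands agree pointwise.
  rw [intervalIntegral.integral_of_le hs.2, ← integral_Icc_eq_integral_Ioc (x := s),
    ← integral_indicator measurableSet_Ioc, ← integral_indicator measurableSet_Icc]
  congr 1
  ext x
  by_cases hx : x ∈ Set.Icc s ts
  · rw [Set.indicator_of_mem hx,
      Set.indicator_of_mem (show x ∈ Set.Ioc t₀ ts from ⟨hs.1.trans_le hx.1, hx.2⟩),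
      intervalIntegral.integral_of_le h₁, ← integral_const_mul]
    refine setIntegral_congr_fun measurableSet_Ioc fun x' hx' => ?_
    rw [hg, Set.indicator_of_mem, covarianceDensity, propagator_eq_green]
    · ring
    · exact ⟨hs.1.le, hx.1, hx.2, hx'.1.le, hx'.2⟩
  · rw [Set.indicator_of_notMem hx]
    by_cases hx1 : x ∈ Set.Ioc t₀ ts
    · rw [Set.indicator_of_mem hx1]
      refine (integral_congr_ae (g := fun _ => (0 : ℝ)) ?_).trans (by simp)
      refine Filter.Eventually.of_forall fun x' => ?_
      simp only
      rw [hg, Set.indicator_of_notMem]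
      exact fun h => hx ⟨h.2.1, hx1.2⟩
    · rw [Set.indicator_of_notMem hx1]

/-! ### Forward rates along the path of spot rates and the terminal curve -/

lemma measurableSet_rateDomain (TFR t₀ : ℝ) : MeasurableSet (rateDomain TFR t₀) := by
  simp only [rateDomain, Set.ofPred_and]
  exact (measurableSet_le measurable_const measurable_fst).inter
    ((measurableSet_le measurable_fst measurable_snd).inter
      (measurableSet_le measurable_snd measurable_const))

/-- The deterministic part of the rate of maturity `x` at the time `min x ts`. -/
def meanRate (α : ℝ → ℝ → ℝ) (f₀ : ℝ → ℝ) (t₀ ts x : ℝ) : ℝ :=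
  f₀ x + ∫ s in t₀..min x ts, α s x

/-- The random part of the rate of maturity `x` at the time `min x ts`. -/
def rateNoise {Ω : Type*} (α : ℝ → ℝ → ℝ) (f₀ : ℝ → ℝ) (f : ℝ → ℝ → Ω → ℝ) (t₀ ts x : ℝ)
    (ω : Ω) : ℝ :=
  f (min x ts) x ω - meanRate α f₀ t₀ ts x

section Rates

variable {Ω : Type*} [MeasurableSpace Ω] {Q : Measure Ω} {μ TFR t₀ ts T : ℝ}
  {A : ℝ → (ℝ → ℝ) → Ω → ℝ} {α σ : ℝ → ℝ → ℝ} {f₀ : ℝ → ℝ} {f : ℝ → ℝ → Ω → ℝ}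

/-- The time `min x ts` treats two families of rates at once: for `x ≤ ts` it selects the spot rate
`f(x, x)`, for `x ≥ ts` the terminal curve `f(ts, x)`. -/
lemma mem_rateDomain_min (h₀ : t₀ ≤ ts) (h₂ : T ≤ t₀ + TFR) {x : ℝ} (hx : x ∈ Set.Ioc t₀ T) :
    (min x ts, x) ∈ rateDomain TFR t₀ :=
  ⟨le_min hx.1.le h₀, min_le_left _ _, hx.2.trans h₂⟩

lemma IsForwardRate.meanRate_integrable (hf : IsForwardRate Q TFR t₀ A α σ f₀ f)
    (h₀ : t₀ ≤ ts) (h₂ : T ≤ t₀ + TFR) :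
    IntegrableOn (meanRate α f₀ t₀ ts) (Set.Ioc t₀ T) := by
  have hE : MeasurableSet (rateDomain TFR t₀ ∩ {p | p.1 ≤ ts}) :=
    (measurableSet_rateDomain TFR t₀).inter (measurableSet_le measurable_fst measurable_const)
  have h1 := (integrable_indicator_iff hE).2
    (hf.drift_integrable.mono_set Set.inter_subset_left)
  rw [Measure.volume_eq_prod] at h1
  have h2 := h1.integral_prod_right.integrableOn (s := Set.Ioc t₀ T)
  refine (hf.initial_integrable.mono_set fun x hx => ⟨hx.1.le, hx.2.trans h₂⟩).add
    (h2.congr_fun (fun x hx => ?_) measurableSet_Ioc)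
  simp only
  rw [intervalIntegral.integral_of_le (le_min hx.1.le h₀), ← integral_Icc_eq_integral_Ioc,
    ← integral_indicator measurableSet_Icc]
  congr 1
  ext s
  have hiff : (s, x) ∈ rateDomain TFR t₀ ∩ {p | p.1 ≤ ts} ↔ s ∈ Set.Icc t₀ (min x ts) := by
    constructor
    · rintro ⟨⟨a, b, -⟩, c⟩
      exact ⟨a, le_min b c⟩
    · rintro ⟨a, b⟩
      exact ⟨⟨a, b.trans (min_le_left _ _), hx.2.trans h₂⟩, b.trans (min_le_right _ _)⟩
  by_cases hs : s ∈ Set.Icc t₀ (min x ts)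
  · rw [Set.indicator_of_mem hs, Set.indicator_of_mem (hiff.2 hs)]; rfl
  · rw [Set.indicator_of_notMem hs, Set.indicator_of_notMem (mt hiff.1 hs)]

/-- The exceptional null set depends on `x`, so the identity is used one maturity at a time and
integrals over `x` are reached only through joint measurability and Fubini. -/
lemma IsForwardRate.rateNoise_ae_eq (hf : IsForwardRate Q TFR t₀ A α σ f₀ f)
    (h₀ : t₀ ≤ ts) (h₂ : T ≤ t₀ + TFR) {x : ℝ} (hx : x ∈ Set.Ioc t₀ T) :
    rateNoise α f₀ f t₀ ts x =ᵐ[Q] A x (rateSource σ t₀ (min x ts) x) := by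
  filter_upwards [hf.evolution _ _ (mem_rateDomain_min h₀ h₂ hx)] with ω hω
  rw [rateNoise, hω, meanRate, rateSource]
  ring

lemma IsActionField.memLp (hA : IsActionField Q μ TFR t₀ A) (p : sources TFR t₀) :
    MemLp (A p.1.1 p.1.2) 2 Q :=
  (hA.gaussian.hasGaussianLaw_eval p).memLp_two

variable [IsProbabilityMeasure Q]

lemma integral_rateNoise_mul (hμ : μ ≠ 0) (hTFR : 0 < TFR) (hA : IsActionField Q μ TFR t₀ A)
    (hf : IsForwardRate Q TFR t₀ A α σ f₀ f) (h₀ : t₀ ≤ ts) (h₂ : T ≤ t₀ + TFR) {x x' : ℝ}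
    (hx : x ∈ Set.Ioc t₀ T) (hx' : x' ∈ Set.Ioc t₀ T) :
    ∫ ω, rateNoise α f₀ f t₀ ts x ω * rateNoise α f₀ f t₀ ts x' ω ∂Q
      = ∫ s in t₀..min (min x ts) (min x' ts), covarianceDensity μ TFR σ s x x' := by
  obtain ⟨C, hC⟩ := hf.volatility_bounded
  have hd := mem_rateDomain_min h₀ h₂ hx
  have hd' := mem_rateDomain_min h₀ h₂ hx'
  have hs := rateSource_mem hf.volatility_measurable hC hd
  have hs' := rateSource_mem hf.volatility_measurable hC hd'
  have hcov := hA.covariance_rateSource hμ hTFR hf.volatility_measurable hC hd hd'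
  have hc := hA.centred _ hs
  simp only at hc
  rw [covariance_eq_sub (hA.memLp ⟨_, hs⟩) (hA.memLp ⟨_, hs'⟩), hc, zero_mul, sub_zero] at hcov
  refine Eq.trans (integral_congr_ae ?_) hcov
  filter_upwards [hf.rateNoise_ae_eq h₀ h₂ hx, hf.rateNoise_ae_eq h₀ h₂ hx'] with ω e e'
  rw [e, e']
  rfl

/-- The noise of the forward rates is a square integrable field in the Gaussian Hilbert space. -/
lemma memLp_rateNoise (hμ : μ ≠ 0) (hTFR : 0 < TFR) (hA : IsActionField Q μ TFR t₀ A)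
    (hf : IsForwardRate Q TFR t₀ A α σ f₀ f) (h₀ : t₀ ≤ ts) (h₂ : T ≤ t₀ + TFR) {I : Set ℝ}
    (hI : I ⊆ Set.Ioc t₀ T) (hIm : MeasurableSet I) :
    MemLp (Function.uncurry (rateNoise α f₀ f t₀ ts)) 2 ((volume.restrict I).prod Q) ∧
      ∀ᵐ x ∂volume.restrict I, ∃ v ∈ closedSpan hA.memLp,
        v =ᵐ[Q] rateNoise α f₀ f t₀ ts x := by
  obtain ⟨C, hC⟩ := hf.volatility_bounded
  have hmem : ∀ x ∈ I, ∃ v ∈ closedSpan hA.memLp, v =ᵐ[Q] rateNoise α f₀ f t₀ ts x := by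
    intro x hx
    have hs := rateSource_mem hf.volatility_measurable hC (mem_rateDomain_min h₀ h₂ (hI hx))
    refine ⟨(hA.memLp ⟨_, hs⟩).toLp, Submodule.le_topologicalClosure _
      (Submodule.subset_span ⟨_, rfl⟩), ?_⟩
    exact (hA.memLp ⟨_, hs⟩).coeFn_toLp.trans (hf.rateNoise_ae_eq h₀ h₂ (hI hx)).symm
  have : IsFiniteMeasure (volume.restrict I) :=
    isFiniteMeasure_restrict.2 ((measure_mono hI).trans_lt measure_Ioc_lt_top).ne
  -- The second moment is an integral of the covariance density, bounded by `C² * greenBound`, over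
  -- the times from `t₀` to `min x ts`, an interval of length at most `TFR`.
  refine ⟨memLp_uncurry_of_sq_le (K := C * C * greenBound μ TFR * TFR) ?_ ?_,
    (ae_restrict_iff' hIm).2 (Filter.Eventually.of_forall hmem)⟩
  · have h1 : Measurable fun p : ℝ × Ω => f (min p.1 ts) p.1 p.2 :=
      hf.measurable.comp ((measurable_fst.min measurable_const).prodMk
        (measurable_fst.prodMk measurable_snd))
    have h2 := ((hf.meanRate_integrable (T := T) h₀ h₂).mono_set hI).1.comp_fst (ν := Q)
    exact h1.aestronglyMeasurable.sub h2
  · refine (ae_restrict_iff' hIm).2 (Filter.Eventually.of_forall fun x hx => ?_)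
    obtain ⟨v, -, hv⟩ := hmem x hx
    refine ⟨(Lp.memLp v).ae_eq hv, ?_⟩
    have hx' := hI hx
    have hd := mem_rateDomain_min (TFR := TFR) h₀ h₂ hx'
    have h1 := integral_rateNoise_mul hμ hTFR hA hf h₀ h₂ hx' hx'
    rw [min_self] at h1
    simp_rw [pow_two]
    rw [h1]
    have hB := (abs_nonneg _).trans (abs_covarianceDensity_le hμ hTFR hC hd hd)
    have h2 := intervalIntegral.norm_integral_le_of_norm_le_const (a := t₀) (b := min x ts)
      (f := fun s => covarianceDensity μ TFR σ s x x) (C := C * C * greenBound μ TFR)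
      (fun s hs => by
        rw [Set.uIoc_of_le hd.1] at hs
        have : (s, x) ∈ rateDomain TFR t₀ := ⟨hs.1.le, hs.2.trans hd.2.1, hd.2.2⟩
        exact abs_covarianceDensity_le hμ hTFR hC this this)
    refine (le_abs_self _).trans (h2.trans ?_)
    have h3 : |min x ts - t₀| ≤ TFR := by
      rw [abs_of_nonneg (sub_nonneg.2 hd.1)]
      linarith [hd.2.1, hd.2.2]
    gcongr

/-- The integrated covariance of the spot rates with the terminal curve. -/
lemma integral_noise_mul_noise (hμ : μ ≠ 0) (hTFR : 0 < TFR) (hA : IsActionField Q μ TFR t₀ A)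
    (hf : IsForwardRate Q TFR t₀ A α σ f₀ f) (h₀ : t₀ ≤ ts) (h₁ : ts ≤ T)
    (h₂ : T ≤ t₀ + TFR) :
    ∫ ω, (∫ x in Set.Ioc ts T, rateNoise α f₀ f t₀ ts x ω) *
        (∫ x in Set.Ioc t₀ ts, rateNoise α f₀ f t₀ ts x ω) ∂Q
      = -futuresExponent μ TFR σ t₀ ts T := by
  obtain ⟨C, hC⟩ := hf.volatility_bounded
  have hI1 : Set.Ioc t₀ ts ⊆ Set.Ioc t₀ T := Set.Ioc_subset_Ioc_right h₁
  have hI2 : Set.Ioc ts T ⊆ Set.Ioc t₀ T := Set.Ioc_subset_Ioc_left h₀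
  obtain ⟨m1, v1⟩ := memLp_rateNoise hμ hTFR hA hf h₀ h₂ hI1 measurableSet_Ioc
  obtain ⟨m2, -⟩ := memLp_rateNoise hμ hTFR hA hf h₀ h₂ hI2 measurableSet_Ioc
  rw [integral_mul_integral m1 (memLp_integral_left m2),
    ← neg_futuresExponent_eq hμ hTFR h₀ h₁ h₂ hf.volatility_measurable hC]
  refine integral_congr_ae ?_
  filter_upwards [v1, ae_restrict_mem measurableSet_Ioc] with x ⟨v, _, hv⟩ hx
  simp_rw [mul_comm _ (rateNoise α f₀ f t₀ ts x _)]
  rw [integral_mul_integral m2 ((Lp.memLp v).ae_eq hv)]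
  refine setIntegral_congr_fun measurableSet_Ioc fun x' hx' => ?_
  -- Here `x ≤ ts < x'`: the spot rate of maturity `x` stops accumulating noise at time `x`, so the
  -- common past ends there.
  rw [integral_rateNoise_mul hμ hTFR hA hf h₀ h₂ (hI1 hx) (hI2 hx'), min_eq_left hx.2,
    min_eq_right hx'.1.le, min_eq_left hx.2]

/-- The rates on a set of maturities are almost surely integrable, and their integral splits into
its mean and the integrated noise. -/
lemma ae_integrable_rate (hμ : μ ≠ 0) (hTFR : 0 < TFR) (hA : IsActionField Q μ TFR t₀ A)
    (hf : IsForwardRate Q TFR t₀ A α σ f₀ f) (h₀ : t₀ ≤ ts) (h₂ : T ≤ t₀ + TFR) {I : Set ℝ}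
    (hI : I ⊆ Set.Ioc t₀ T) (hIm : MeasurableSet I) :
    ∀ᵐ ω ∂Q, IntegrableOn (fun x => f (min x ts) x ω) I ∧
      ∫ x in I, f (min x ts) x ω = (∫ x in I, meanRate α f₀ t₀ ts x)
        + ∫ x in I, rateNoise α f₀ f t₀ ts x ω := by
  have : IsFiniteMeasure (volume.restrict I) :=
    isFiniteMeasure_restrict.2 ((measure_mono hI).trans_lt measure_Ioc_lt_top).ne
  obtain ⟨m, -⟩ := memLp_rateNoise hμ hTFR hA hf h₀ h₂ hI hIm
  have hd : IntegrableOn (meanRate α f₀ t₀ ts) I :=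
    (hf.meanRate_integrable (T := T) h₀ h₂).mono_set hI
  filter_upwards [(m.integrable (by norm_num)).prod_left_ae] with ω hω
  have hω' : IntegrableOn (fun x => rateNoise α f₀ f t₀ ts x ω) I := hω
  have he : (fun x => f (min x ts) x ω)
      = fun x => meanRate α f₀ t₀ ts x + rateNoise α f₀ f t₀ ts x ω := by
    ext x
    rw [rateNoise]
    ring
  rw [he]
  exact ⟨hd.add hω', integral_add hd hω'⟩

/-- The futures price is the forward price corrected by the exponential of the covariance of the
integrated spot rate with the terminal curve. -/
theorem futuresPrice_eq (hμ : μ ≠ 0) (hTFR : 0 < TFR) (hA : IsActionField Q μ TFR t₀ A)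
    (hf : IsForwardRate Q TFR t₀ A α σ f₀ f) (hQ : IsRiskNeutral Q TFR t₀ f₀ f)
    (h₀ : t₀ ≤ ts) (h₁ : ts ≤ T) (h₂ : T ≤ t₀ + TFR) :
    (∀ᵐ ω ∂Q, IntervalIntegrable (fun x => f ts x ω) volume ts T) ∧
      Integrable (fun ω => bondPrice (fun x => f ts x ω) ts T) Q ∧
      futuresPrice Q f ts T =
        forwardPrice f₀ t₀ ts T * Real.exp (futuresExponent μ TFR σ t₀ ts T) := by
  have hI1 : Set.Ioc t₀ ts ⊆ Set.Ioc t₀ T := Set.Ioc_subset_Ioc_right h₁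
  have hI2 : Set.Ioc ts T ⊆ Set.Ioc t₀ T := Set.Ioc_subset_Ioc_left h₀
  obtain ⟨m1, v1⟩ := memLp_rateNoise hμ hTFR hA hf h₀ h₂ hI1 measurableSet_Ioc
  obtain ⟨m2, v2⟩ := memLp_rateNoise hμ hTFR hA hf h₀ h₂ hI2 measurableSet_Ioc
  have hcl : IsClosed (closedSpan hA.memLp : Set (Lp ℝ 2 Q)) :=
    Submodule.isClosed_topologicalClosure _
  set G1 : Ω → ℝ := fun ω => ∫ x in Set.Ioc t₀ ts, rateNoise α f₀ f t₀ ts x ω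
  set G2 : Ω → ℝ := fun ω => ∫ x in Set.Ioc ts T, rateNoise α f₀ f t₀ ts x ω
  set D1 := ∫ x in Set.Ioc t₀ ts, meanRate α f₀ t₀ ts x
  set D2 := ∫ x in Set.Ioc ts T, meanRate α f₀ t₀ ts x
  have g1 := exists_mem_closedSubmodule_integral m1 hcl v1
  have g2 := exists_mem_closedSubmodule_integral m2 hcl v2
  -- The sum lies in the same closed span, hence is Gaussian; no joint law of `G1` and `G2` is
  -- needed.
  have g12 : ∃ v ∈ closedSpan hA.memLp, v =ᵐ[Q] fun ω => G1 ω + G2 ω := by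
    obtain ⟨w1, hw1, e1⟩ := g1
    obtain ⟨w2, hw2, e2⟩ := g2
    refine ⟨w1 + w2, add_mem hw1 hw2, ?_⟩
    filter_upwards [Lp.coeFn_add w1 w2, e1, e2] with ω e a b
    rw [e, Pi.add_apply, a, b]
  have hc : ∀ p : sources TFR t₀, ∫ ω, A p.1.1 p.1.2 ω ∂Q = 0 := fun p => hA.centred p.1 p.2
  obtain ⟨-, x1⟩ := integral_exp_neg_of_mem_closedSpan hA.memLp hA.gaussian hc g1
  obtain ⟨i2, x2⟩ := integral_exp_neg_of_mem_closedSpan hA.memLp hA.gaussian hc g2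
  obtain ⟨-, x12⟩ := integral_exp_neg_of_mem_closedSpan hA.memLp hA.gaussian hc g12
  have l1 : MemLp G1 2 Q := memLp_integral_left m1
  have l2 : MemLp G2 2 Q := memLp_integral_left m2
  have hsq : ∫ ω, (G1 ω + G2 ω) ^ 2 ∂Q = ∫ ω, G1 ω ^ 2 ∂Q + ∫ ω, G2 ω ^ 2 ∂Q
      - 2 * futuresExponent μ TFR σ t₀ ts T := by
    have hx := integral_noise_mul_noise hμ hTFR hA hf h₀ h₁ h₂
    have he : ∀ ω, (G1 ω + G2 ω) ^ 2 = G1 ω ^ 2 + G2 ω ^ 2 + 2 * (G2 ω * G1 ω) := fun ω => by ring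
    have hi : Integrable (fun ω => G1 ω ^ 2 + G2 ω ^ 2) Q := l1.integrable_sq.add l2.integrable_sq
    have hi' : Integrable (fun ω => G2 ω * G1 ω) Q := l2.integrable_mul l1
    simp_rw [he]
    rw [integral_add hi (hi'.const_mul 2), integral_add l1.integrable_sq l2.integrable_sq,
      integral_const_mul, hx]
    ring
  have r1 := ae_integrable_rate hμ hTFR hA hf h₀ h₂ hI1 measurableSet_Ioc
  have r2 := ae_integrable_rate hμ hTFR hA hf h₀ h₂ hI2 measurableSet_Ioc
  have spot : ∀ᵐ ω ∂Q, ∫ t in t₀..ts, f t t ω = D1 + G1 ω := by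
    filter_upwards [r1] with ω hω
    rw [← hω.2, intervalIntegral.integral_of_le h₀]
    refine setIntegral_congr_fun measurableSet_Ioc fun x hx => ?_
    simp only [min_eq_left hx.2]
  have curve : ∀ᵐ ω ∂Q, bondPrice (fun x => f ts x ω) ts T
      = Real.exp (-D2) * Real.exp (-G2 ω) := by
    filter_upwards [r2] with ω hω
    have : ∫ x in ts..T, f ts x ω = D2 + G2 ω := by
      rw [← hω.2, intervalIntegral.integral_of_le h₁]
      refine setIntegral_congr_fun measurableSet_Ioc fun x hx => ?_
      simp only [min_eq_right hx.1.le]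
    rw [bondPrice, this, neg_add, Real.exp_add]
  refine ⟨?_, (i2.const_mul _).congr (by filter_upwards [curve] with ω h using h.symm), ?_⟩
  · filter_upwards [r2] with ω hω
    rw [intervalIntegrable_iff_integrableOn_Ioc_of_le h₁]
    refine hω.1.congr_fun (fun x hx => ?_) measurableSet_Ioc
    simp only [min_eq_right hx.1.le]
  · have hfut : futuresPrice Q f ts T = Real.exp (-D2) * Real.exp ((∫ ω, G2 ω ^ 2 ∂Q) / 2) := by
      rw [futuresPrice, integral_congr_ae curve, integral_const_mul, x2]
    have hP : bondPrice f₀ t₀ T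
        = Real.exp (-(D1 + D2)) * Real.exp ((∫ ω, (G1 ω + G2 ω) ^ 2 ∂Q) / 2) := by
      rw [hQ ts T h₀ h₁ h₂, ← x12, ← integral_const_mul]
      refine integral_congr_ae ?_
      filter_upwards [spot, curve] with ω a b
      rw [a, b, ← Real.exp_add, ← Real.exp_add, ← Real.exp_add]
      ring_nf
    -- Risk neutrality with maturity equal to the expiry `ts`, where the bond pays 1 and only the
    -- discount factor remains.
    have hP' : bondPrice f₀ t₀ ts = Real.exp (-D1) * Real.exp ((∫ ω, G1 ω ^ 2 ∂Q) / 2) := by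
      rw [hQ ts ts h₀ le_rfl (h₁.trans h₂), ← x1, ← integral_const_mul]
      refine integral_congr_ae ?_
      filter_upwards [spot] with ω a
      rw [a, bondPrice, intervalIntegral.integral_same, neg_zero, Real.exp_zero, mul_one,
        ← Real.exp_add, neg_add]
    -- All factors become one exponential; `D1` and the variance of `G1` cancel, and the cross term
    -- in `hsq` offsets the futures exponent.
    rw [hfut, forwardPrice, hP, hP', hsq, ← Real.exp_add, ← Real.exp_add, ← Real.exp_add,
      ← Real.exp_sub, ← Real.exp_add]
    congr 1
    ring

end Rates

end FieldTheory

end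

theorem mainTheorem4 {Ω : Type*} [MeasurableSpace Ω] (Q : Measure Ω) [IsProbabilityMeasure Q]
    (μ TFR t₀ : ℝ) (hμ : μ ≠ 0) (hTFR : 0 < TFR)
    (A : ℝ → (ℝ → ℝ) → Ω → ℝ) (hA : FieldTheory.IsActionField Q μ TFR t₀ A)
    (α σ : ℝ → ℝ → ℝ) (f₀ : ℝ → ℝ) (f : ℝ → ℝ → Ω → ℝ)
    (hf : FieldTheory.IsForwardRate Q TFR t₀ A α σ f₀ f)
    (hQ : FieldTheory.IsRiskNeutral Q TFR t₀ f₀ f)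
    (ts T : ℝ) (h₀ : t₀ ≤ ts) (h₁ : ts ≤ T) (h₂ : T ≤ t₀ + TFR) :
    (∀ᵐ ω ∂Q, IntervalIntegrable (fun x => f ts x ω) volume ts T) ∧
      Integrable (fun ω => FieldTheory.bondPrice (fun x => f ts x ω) ts T) Q ∧
      FieldTheory.futuresPrice Q f ts T =
        FieldTheory.forwardPrice f₀ t₀ ts T *
          Real.exp (FieldTheory.futuresExponent μ TFR σ t₀ ts T) :=
  FieldTheory.futuresPrice_eq hμ hTFR hA hf hQ h₀ h₁ h₂
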